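/- **Setting.** Let $\mu_n$ be the law of a Haar random pure state on $n$ qubits. A unital noise channel on $n$ qubits is a completely positive trace preserving map $\Gamma(\rho)=\sum_i E_i\rho E_i^\dagger$ with $\Gamma(I)=I$. An algorithm $W$ without quantum memory, with $T$ copies, measures $T$ copies of the unknown state one at a time, each by an arbitrary POVM that may depend on all previous outcomes, and then accepts or rejects depending on the outcomes; $W(\rho)$ denotes its acceptance probability on copies of $\rho$. It distinguishes two ensembles of states with advantage at least $\varepsilon$ if its average acceptance probabilities on the two ensembles (one state is drawn, all copies are of that state) differ by at least $\varepsilon$. A *quantum polynomial time* algorithm without quantum memory is a family of such algorithms (one for each $n$) with polynomially many copies and polynomially many bits of classical memory, in which the measurement in each round, the update of the classical memory, and the decision are performed by a polynomial time uniform family of quantum circuits acting on the current copy, the classical memory and fresh ancillas. A *memoryless PRS* is a keyed family of pure $n$-qubit states $\{|\phi_k\rangle\}_{k\in\{0,1\}^{\kappa(n)}}$, $\kappa$ a polynomial, that can be generated efficiently from the key and such that every quantum polynomial time algorithm without quantum memory distinguishes copies of $|\phi_k\rangle$ ($k$ uniform) from copies of a Haar random state with negligible advantage only. A family of channels is efficiently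 implementable if it is performed, up to a negligible error in trace distance, by a polynomial time uniform family of circuits with polynomially many ancillas. **Theorem.** 1. (Noisy Haar states, any unital noise, any memoryless adversary.) There is an absolute constant $c>0$ such that for all $n$, all unital channels $\Gamma$ on $n$ qubits and all $\varepsilon>0$, every algorithm without quantum memory that distinguishes $\Gamma(|\psi\rangle\langle\psi|)$, $\psi\sim\mu_n$, with advantage at least $\varepsilon$ from the maximally mixed state $I/2^n$, or from a (noiseless) Haar random state, uses at least $c\sqrt{\varepsilon}\,2^{n/2}$ copies. 2. (Pseudorandom families, any unital noise, any memoryless adversary.) There is an absolute constant $c>0$ such that the following holds for all $n$, $T$, all unital channels $\Gamma$ on $n$ qubits, all finite keyed families $\{|\phi_k\rangle\}_{k\in K}$ of pure $n$-qubit states and all $\delta$. If every algorithm without quantum memory that uses $T$ copies distinguishes $|\phi_k\rangle$ ($k$ uniform) from Haar random states with advantage at most $\delta$, and some algorithm without quantum memory that uses $T$ copies distinguishes the noisy states $\Gamma(|\phi_k\rangle\langle\phi_k|)$ from (noiseless) Haar random states with advantage at least $\delta+\varepsilon$, $\varepsilon>0$, then $T\ge c\sqrt{\varepsilon}\,2^{n/2}$.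 3. (Memoryless PRS, efficient unital noise, efficient memoryless adversary.) Let $\{|\phi_k\rangle\}_k$ be a memoryless PRS and $(\Gamma_n)_n$ an efficiently implementable family of unital channels. Then every quantum polynomial time algorithm without quantum memory distinguishes copies of $\Gamma_n(|\phi_k\rangle\langle\phi_k|)$ ($k$ uniform) from copies of a (noiseless) Haar random state with negligible advantage only; so superpolynomial resources are needed. -/

import Mathlib

open MeasureTheory
open scoped ComplexOrder

namespace MemorylessPRS

noncomputable section

/-! ### States, channels, Haar random states -/

/-- Operators on a register of qubits labelled by `Q`, written in the computational basis
`Q → Bool`. -/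
abbrev Op (Q : Type) : Type := Matrix (Q → Bool) (Q → Bool) ℂ

/-- Operators on `n` qubits. -/
abbrev QMat (n : ℕ) : Type := Op (Fin n)

/-- Unit vectors of the `n`-qubit space `ℂ^(2^n)`. -/
abbrev PureState (n : ℕ) : Type :=
  Metric.sphere (0 : EuclideanSpace ℂ (Fin n → Bool)) 1

/-- The density matrix `|ψ⟩⟨ψ|`. -/
def proj {n : ℕ} (ψ : PureState n) : QMat n :=
  fun x y => ψ.1 x * star (ψ.1 y)

/-- The maximally mixed state `I / 2^n`. -/
def maxMixed (n : ℕ) : QMat n := ((2 : ℂ) ^ n)⁻¹ • (1 : QMat n)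

/-- The law of a Haar random pure state: the rotation invariant probability measure on the unit
sphere (the normalised surface measure). -/
def haar (n : ℕ) : Measure (PureState n) :=
  ((volume : Measure (EuclideanSpace ℂ (Fin n → Bool))).toSphere Set.univ)⁻¹ •
    (volume : Measure (EuclideanSpace ℂ (Fin n → Bool))).toSphere

/-- Quantum channels (completely positive trace preserving maps) in Kraus form. -/
def IsChannel {n : ℕ} (Γ : QMat n → QMat n) : Prop :=
  ∃ (r : ℕ) (E : Fin r → QMat n), (∑ i, (E i).conjTranspose * E i = 1) ∧
    ∀ ρ, Γ ρ = ∑ i, E i * ρ * (E i).conjTranspose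

/-- Unital channels: the identity is a fixed point. -/
def IsUnitalChannel {n : ℕ} (Γ : QMat n → QMat n) : Prop :=
  IsChannel Γ ∧ Γ 1 = 1

/-- `A` and `B` (two density matrices) are at trace distance at most `ε`: no effect `0 ≤ E ≤ 1`
distinguishes them better than that. -/
def TraceClose {n : ℕ} (ε : ℝ) (A B : QMat n) : Prop :=
  ∀ E : QMat n, E.PosSemidef → (1 - E).PosSemidef → ‖(E * (A - B)).trace‖ ≤ ε

/-! ### Algorithms without quantum memory -/

/-- An algorithm without quantum memory on `n`-qubit states. It asks for `copies` copies of the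
unknown state, one at a time, and measures each of them by a POVM `povm h` that is chosen
depending on the list `h` of all the previous outcomes (the most recent one first); at the end it
accepts or rejects depending on the list of outcomes. All POVMs share one finite set of labels, of
arbitrary size (a POVM with fewer outcomes is padded by zero operators). -/
structure MemorylessAlgorithm (n : ℕ) where
  copies : ℕ
  Out : Type
  [fintypeOut : Fintype Out]
  povm : List Out → Out → QMat n
  posSemidef : ∀ h o, (povm h o).PosSemidef
  sum_eq_one : ∀ h, ∑ o, povm h o = 1
  accept : List Out → Bool

attribute [instance] MemorylessAlgorithm.fintypeOut

/-- Probability of acceptance when the outcomes `h` have been recorded and `t` copies of `ρ` are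
still to be measured. -/
def MemorylessAlgorithm.acceptFrom {n : ℕ} (W : MemorylessAlgorithm n) (ρ : QMat n) :
    ℕ → List W.Out → ℝ
  | 0, h => if W.accept h then 1 else 0
  | t + 1, h => ∑ o, ((W.povm h o * ρ).trace).re * W.acceptFrom ρ t (o :: h)

/-- Probability that `W` accepts when all its copies are in the state `ρ`. -/
def MemorylessAlgorithm.acceptProb {n : ℕ} (W : MemorylessAlgorithm n) (ρ : QMat n) : ℝ :=
  W.acceptFrom ρ W.copies []

/-- Probability that `W` accepts copies of `Γ (|ψ⟩⟨ψ|)`, for one Haar random `ψ`. -/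
def MemorylessAlgorithm.haarProb {n : ℕ} (W : MemorylessAlgorithm n) (Γ : QMat n → QMat n) : ℝ :=
  ∫ ψ, W.acceptProb (Γ (proj ψ)) ∂(haar n)

/-- Probability that `W` accepts copies of `Γ (|φ_k⟩⟨φ_k|)`, for one uniformly random key `k`. -/
def MemorylessAlgorithm.keyProb {n : ℕ} (W : MemorylessAlgorithm n) {K : Type} [Fintype K]
    (φ : K → PureState n) (Γ : QMat n → QMat n) : ℝ :=
  (Fintype.card K : ℝ)⁻¹ * ∑ k, W.acceptProb (Γ (proj (φ k)))

/-! ### Quantum circuits -/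

/-- Gates on qubits labelled by `Q`: Hadamard, `π/8` gate, controlled not (first argument:
control), and reset of a qubit to `|0⟩`. -/
inductive Gate (Q : Type) where
  | had (w : Q)
  | tee (w : Q)
  | cnot (c w : Q)
  | reset (w : Q)

/-- The single-qubit matrix `u` acting on qubit `w`. -/
def onQubit {Q : Type} [Fintype Q] [DecidableEq Q] (w : Q) (u : Matrix Bool Bool ℂ) : Op Q :=
  fun x y => if ∀ v, v ≠ w → x v = y v then u (x w) (y w) else 0

def hadMatrix : Matrix Bool Bool ℂ :=
  fun i j => ((Real.sqrt 2 : ℝ) : ℂ)⁻¹ * (if i && j then -1 else 1)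

def teeMatrix : Matrix Bool Bool ℂ :=
  fun i j => if i = j then
    (if i then Complex.exp (Complex.I * (Real.pi : ℂ) / 4) else 1) else 0

/-- `|0⟩⟨b|`. -/
def resetMatrix (b : Bool) : Matrix Bool Bool ℂ :=
  fun i j => if i = false ∧ j = b then 1 else 0

def cnotMatrix {Q : Type} [Fintype Q] [DecidableEq Q] (c w : Q) : Op Q :=
  fun x y => if x = Function.update y w (xor (y w) (y c)) then 1 else 0

/-- The action of a gate on density matrices. -/
def Gate.apply {Q : Type} [Fintype Q] [DecidableEq Q] : Gate Q → Op Q → Op Q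
  | .had w, ρ => onQubit w hadMatrix * ρ * (onQubit w hadMatrix).conjTranspose
  | .tee w, ρ => onQubit w teeMatrix * ρ * (onQubit w teeMatrix).conjTranspose
  | .cnot c w, ρ => cnotMatrix c w * ρ * (cnotMatrix c w).conjTranspose
  | .reset w, ρ =>
      ∑ b, onQubit w (resetMatrix b) * ρ * (onQubit w (resetMatrix b)).conjTranspose

/-- Names of qubits: the `i`-th qubit of the state register, of the register of classical bits,
or of the ancilla register. -/
inductive Wire where
  | state (i : ℕ)
  | bit (i : ℕ)
  | anc (i : ℕ)

/-- A register of `n` state qubits, `s` qubits that hold classical bits, and `a` ancillas. -/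
abbrev Reg (n s a : ℕ) : Type := Fin n ⊕ Fin s ⊕ Fin a

def Wire.locate (n s a : ℕ) : Wire → Option (Reg n s a)
  | .state i => if h : i < n then some (.inl ⟨i, h⟩) else none
  | .bit i => if h : i < s then some (.inr (.inl ⟨i, h⟩)) else none
  | .anc i => if h : i < a then some (.inr (.inr ⟨i, h⟩)) else none

def Gate.locate (n s a : ℕ) : Gate Wire → Option (Gate (Reg n s a))
  | .had w => (w.locate n s a).map Gate.had
  | .tee w => (w.locate n s a).map Gate.tee
  | .cnot c w => (c.locate n s a).bind fun c' => (w.locate n s a).map fun w' => Gate.cnot c' w'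
  | .reset w => (w.locate n s a).map Gate.reset

/-- Control and target of a controlled not have to differ. -/
def Gate.Proper {Q : Type} : Gate Q → Prop
  | .cnot c w => c ≠ w
  | _ => True

/-- A circuit is a list of gates, performed from left to right. -/
abbrev Circuit : Type := List (Gate Wire)

/-- All gates are proper and act on qubits that the register has. -/
def Circuit.Valid (C : Circuit) (n s a : ℕ) : Prop :=
  ∀ g ∈ C, g.Proper ∧ (g.locate n s a).isSome

def Circuit.run (C : Circuit) (n s a : ℕ) (ρ : Op (Reg n s a)) : Op (Reg n s a) :=
  (C.filterMap (Gate.locate n s a)).foldl (fun σ g => g.apply σ) ρ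

/-- `ρ ⊗ |m⟩⟨m| ⊗ |0⟩⟨0|`: state register `ρ`, classical bits `m`, ancillas zero. -/
def prepare {n s : ℕ} (a : ℕ) (ρ : QMat n) (m : Fin s → Bool) : Op (Reg n s a) :=
  fun x y =>
    if ((∀ i, x (.inr (.inl i)) = m i) ∧ (∀ i, x (.inr (.inr i)) = false)) ∧
       ((∀ i, y (.inr (.inl i)) = m i) ∧ (∀ i, y (.inr (.inr i)) = false))
    then ρ (fun i => x (.inl i)) (fun i => y (.inl i)) else 0

/-- Probability of reading `m` when the classical bits are measured in the computational basis. -/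
def readProb {n s a : ℕ} (σ : Op (Reg n s a)) (m : Fin s → Bool) : ℂ :=
  ∑ x : Reg n s a → Bool, if ∀ i, x (.inr (.inl i)) = m i then σ x x else 0

/-- The reduced state of the state register. -/
def reduce {n s a : ℕ} (σ : Op (Reg n s a)) : QMat n :=
  fun x y => ∑ z : Fin s ⊕ Fin a → Bool, σ (Sum.elim x z) (Sum.elim y z)

/-! ### Uniformity -/

/-- The alphabet in which circuits are written. -/
inductive Sym where
  | had | tee | cnot | reset | state | bit | anc | one

def Wire.encode : Wire → List Sym
  | .state i => List.replicate i .one ++ [.state]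
  | .bit i => List.replicate i .one ++ [.bit]
  | .anc i => List.replicate i .one ++ [.anc]

def Gate.encode : Gate Wire → List Sym
  | .had w => .had :: w.encode
  | .tee w => .tee :: w.encode
  | .cnot c w => .cnot :: (c.encode ++ w.encode)
  | .reset w => .reset :: w.encode

/-- Polynomial time uniform families of circuits: the description of the `n`-th circuit is
computed from `1^n` by a Turing machine in polynomial time. Closure under concatenation, which
the polynomial time computable functions have, is built in, since Mathlib has no composition
theorem for polynomial time Turing machines. -/
inductive Uniform : (ℕ → Circuit) → Prop
  | machine (C : ℕ → Circuit)
      (h : Nonempty (Turing.TM2ComputableInPolyTime (fun n : ℕ => List.replicate n ())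
        (fun D : Circuit => D.flatMap Gate.encode) C)) : Uniform C
  | append (C D : ℕ → Circuit) (hC : Uniform C) (hD : Uniform D) :
      Uniform (fun n => C n ++ D n)

/-! ### Efficient adversaries, efficient noise, memoryless PRS -/

/-- Negligible functions. -/
def Negligible (f : ℕ → ℝ) : Prop :=
  ∀ c : ℕ, ∃ n₀ : ℕ, ∀ n : ℕ, n₀ < n → f n < ((n : ℝ) ^ c)⁻¹

/-- Quantum polynomial time algorithms without quantum memory. The `n`-th algorithm uses `T(n)`
copies and has `s(n)` bits of classical memory, initially zero. In each round a circuit of a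
uniform polynomial time family acts on the fresh copy, the classical memory and `a(n)` fresh
ancillas in the state `|0⟩`; then the memory is measured in the computational basis, which gives
the new content of the memory, and all other qubits are discarded. After the last round the
algorithm accepts if and only if the memory bit with index zero is `1`.
As an algorithm without quantum memory, its outcome in each round is the new memory content. -/
def IsQPT (W : ∀ n, MemorylessAlgorithm n) : Prop :=
  ∃ (C : ℕ → Circuit) (T s a : Polynomial ℕ), Uniform C ∧
    (∀ n, (C n).Valid n (s.eval n) (a.eval n)) ∧
    ∀ n, (W n).copies = T.eval n ∧
      ∃ e : (W n).Out ≃ (Fin (s.eval n) → Bool),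
        let memory : List (W n).Out → (Fin (s.eval n) → Bool) :=
          fun h => (h.head?.map e).getD (fun _ => false)
        (∀ h o ρ, ((W n).povm h o * ρ).trace =
          readProb ((C n).run n (s.eval n) (a.eval n) (prepare (a.eval n) ρ (memory h))) (e o)) ∧
        (∀ h, (W n).accept h = true ↔ ∃ i, i.val = 0 ∧ memory h i = true)

/-- Efficiently implementable noise: up to a negligible error in trace distance, `Γ n` is performed
by circuits of a uniform polynomial time family with polynomially many ancillas. The ancillas
start in `|0⟩` and are returned in `|0⟩`, which is no restriction as they may be reset. -/
def IsEfficientNoise (Γ : ∀ n, QMat n → QMat n) : Prop :=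
  ∃ (C : ℕ → Circuit) (a : Polynomial ℕ) (Γ' : ∀ n, QMat n → QMat n) (ε : ℕ → ℝ),
    Uniform C ∧ (∀ n, (C n).Valid n 0 (a.eval n)) ∧ (∀ n, IsChannel (Γ' n)) ∧ Negligible ε ∧
    (∀ n ρ, (C n).run n 0 (a.eval n) (prepare (a.eval n) ρ Fin.elim0) =
      prepare (a.eval n) (Γ' n ρ) Fin.elim0) ∧
    ∀ n (ψ : PureState n), TraceClose (ε n) (Γ n (proj ψ)) (Γ' n (proj ψ))

/-- Memoryless pseudorandom states on `n` qubits with key space `{0,1}^κ(n)`: the states can be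
generated efficiently from the key (up to a negligible error in trace distance), and no quantum
polynomial time algorithm without quantum memory distinguishes copies of `|φ_k⟩`, for a uniformly
random key `k`, from copies of a Haar random state with more than negligible advantage. -/
structure IsMemorylessPRS (κ : Polynomial ℕ)
    (φ : ∀ n, (Fin (κ.eval n) → Bool) → PureState n) : Prop where
  efficient_generation : ∃ (C : ℕ → Circuit) (a : Polynomial ℕ) (ε : ℕ → ℝ),
    Uniform C ∧ (∀ n, (C n).Valid n (κ.eval n) (a.eval n)) ∧ Negligible ε ∧
    ∀ n k, TraceClose (ε n)
      (reduce ((C n).run n (κ.eval n) (a.eval n)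
        (prepare (a.eval n) (Matrix.single (fun _ => false) (fun _ => false) 1) k)))
      (proj (φ n k))
  indistinguishable : ∀ W : ∀ n, MemorylessAlgorithm n, IsQPT W →
    Negligible fun n => |(W n).keyProb (φ n) id - (W n).haarProb id|

end

end MemorylessPRS

open MemorylessPRS

open scoped Pointwise

namespace MemorylessPRS

noncomputable section

/-! Everything rests on one estimate: an adaptive algorithm with `T` copies and no quantum memory
accepts Haar random states and the maximally mixed state with probabilities that differ by at most
`T ^ 2 / 2 ^ n`.

Writing every effect as `Bᴴ * B`, the likelihood of a record of `t` outcomes on a pure state `ψ` is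
a sum of terms `|p(ψ)|²`, with `p` a product of `t` linear forms in the coordinates of `ψ`.
Measuring one more copy multiplies `p` by a linear form with coefficients `c`. By
`le_haarSq_linForm_mul` this multiplies the Haar mean square by at least `‖c‖² / (2 ^ n + t)`, while
the maximally mixed state has the weight `‖c‖² / 2 ^ n`. The product of the ratios `2 ^ n / (2 ^ n +
t)` over all rounds is at least `1 - T ^ 2 / 2 ^ n`, which bounds the Haar acceptance probability
from below (`le_integral_acceptFrom`). The same bound for the opposite decision is the upper bound.

The growth of the mean square is a creation and annihilation argument. On polynomials of degree `t`,
multiplication by a linear form is adjoint, up to the factor `2 ^ n + t`, to the derivative along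
the conjugate vector (`haarInner_linForm_mul`). The commutator of the two is `‖c‖²`, and the
remaining term is nonnegative. Adjointness is the invariance of the Haar measure under `exp (iθH)`,
differentiated in `θ` and extended from self-adjoint to all operators; no formula for Haar moments
is needed.

Noise is absorbed into the POVM through the adjoint channel, and a unital channel fixes the
maximally mixed state. So the estimate holds for noisy Haar states too, and the triangle inequality
gives the first two claims. For the third, the noise circuit is put in front of the adversary's
circuit, so that the security of the PRS applies to the combined efficient adversary. -/

/-! ### Invariance of the Haar measure on states -/

/-- The restriction of a linear isometry to the unit sphere. -/
def sphereMap {E : Type*} [NormedAddCommGroup E] [NormedSpace ℝ E] (U : E ≃ₗᵢ[ℝ] E)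
    (x : Metric.sphere (0 : E) 1) : Metric.sphere (0 : E) 1 :=
  ⟨U x, by simp⟩

theorem continuous_sphereMap {E : Type*} [NormedAddCommGroup E] [NormedSpace ℝ E]
    (U : E ≃ₗᵢ[ℝ] E) : Continuous (sphereMap U) :=
  Continuous.subtype_mk (U.continuous.comp continuous_subtype_val) _

/-- `toSphere` measures a set, up to a constant, by the volume of the cone over it with radii in
`(0, 1)`, and a linear isometry commutes with forming this cone. -/
theorem measurePreserving_sphereMap {E : Type*} [NormedAddCommGroup E] [NormedSpace ℝ E]
    [MeasurableSpace E] [BorelSpace E] {μ : Measure E} (U : E ≃ₗᵢ[ℝ] E)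
    (hU : MeasurePreserving U μ μ) : MeasurePreserving (sphereMap U) μ.toSphere μ.toSphere := by
  refine ⟨(continuous_sphereMap U).measurable, ?_⟩
  ext s hs
  have hs' := (continuous_sphereMap U).measurable hs
  rw [Measure.map_apply (continuous_sphereMap U).measurable hs, Measure.toSphere_apply' μ hs,
    Measure.toSphere_apply' μ hs']
  congr 1
  have : Set.Ioo (0 : ℝ) 1 • (Subtype.val '' (sphereMap U ⁻¹' s)) =
      U ⁻¹' (Set.Ioo (0 : ℝ) 1 • (Subtype.val '' s)) := by
    ext x
    simp only [Set.mem_smul, Set.mem_image, Set.mem_preimage]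
    constructor
    · rintro ⟨r, hr, _, ⟨y, hy, rfl⟩, rfl⟩
      exact ⟨r, hr, _, ⟨_, hy, rfl⟩, by simp [sphereMap]⟩
    · rintro ⟨r, hr, _, ⟨y, hy, rfl⟩, h⟩
      refine ⟨r, hr, _, ⟨sphereMap U.symm y, ?_, rfl⟩, ?_⟩
      · have : sphereMap U (sphereMap U.symm y) = y := by
          ext; simp [sphereMap]
        rwa [this]
      · apply U.injective
        simp [sphereMap, h]
  rw [this, hU.measure_preimage_emb U.toHomeomorph.measurableEmbedding]

instance (n : ℕ) : IsProbabilityMeasure (haar n) := by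
  have h : (volume : Measure (EuclideanSpace ℂ (Fin n → Bool))).toSphere ≠ 0 :=
    Measure.toSphere_ne_zero _
  constructor
  rw [haar, Measure.smul_apply, smul_eq_mul]
  exact ENNReal.inv_mul_cancel (by simpa only [ne_eq, Measure.measure_univ_eq_zero] using h)
    (measure_ne_top _ _)

theorem integral_haar_comp {n : ℕ}
    (U : EuclideanSpace ℂ (Fin n → Bool) ≃ₗᵢ[ℝ] EuclideanSpace ℂ (Fin n → Bool))
    {f : PureState n → ℂ} (hf : Continuous f) :
    ∫ ψ, f (sphereMap U ψ) ∂(haar n) = ∫ ψ, f ψ ∂(haar n) := by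
  have h : MeasurePreserving (sphereMap U) (haar n) (haar n) :=
    (measurePreserving_sphereMap U U.measurePreserving).smul_measure _
  conv_rhs => rw [← h.map_eq]
  rw [integral_map h.measurable.aemeasurable hf.aestronglyMeasurable]

theorem integrable_haar {n : ℕ} {F : Type*} [NormedAddCommGroup F]
    [SecondCountableTopology F]
    {f : PureState n → F} (hf : Continuous f) : Integrable f (haar n) := by
  obtain ⟨C, hC⟩ := (isCompact_univ (X := PureState n)).exists_bound_of_continuousOn hf.continuousOn
  exact Integrable.of_bound hf.aestronglyMeasurable C (ae_of_all _ fun x => hC x (Set.mem_univ x))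

/-! ### Infinitesimal invariance -/

/-- The derivative of the polynomial `p` at `z` along the vector `w`. -/
def dirDeriv {ι : Type*} [Fintype ι] (p : MvPolynomial ι ℂ) (z w : ι → ℂ) : ℂ :=
  ∑ j, MvPolynomial.eval z (MvPolynomial.pderiv j p) * w j

theorem hasDerivAt_eval {ι : Type*} [Fintype ι] [DecidableEq ι] (p : MvPolynomial ι ℂ)
    {x : ℝ → ι → ℂ} {x' : ι → ℂ} {θ : ℝ} (hx : ∀ j, HasDerivAt (fun s => x s j) (x' j) θ) :
    HasDerivAt (fun s => MvPolynomial.eval (x s) p) (dirDeriv p (x θ) x') θ := by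
  unfold dirDeriv
  induction p using MvPolynomial.induction_on with
  | C a => simpa using hasDerivAt_const θ a
  | add p q hp hq =>
    simp only [map_add, add_mul, Finset.sum_add_distrib]
    exact hp.add hq
  | mul_X p i hp =>
    have := hp.mul (hx i)
    simp only [map_mul, MvPolynomial.eval_X]
    refine this.congr_deriv ?_
    simp only [Derivation.leibniz, MvPolynomial.pderiv_X, smul_eq_mul, map_add, map_mul,
      MvPolynomial.eval_X, add_mul, Finset.sum_add_distrib, Finset.sum_mul]
    rw [add_comm]
    refine congrArg₂ (· + ·) ?_ (Finset.sum_congr rfl fun j _ => by ring)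
    rw [Finset.sum_eq_single i (fun j _ hj => by simp [hj.symm]) (by simp)]
    simp

theorem continuous_dirDeriv {ι X : Type*} [Fintype ι] [TopologicalSpace X] (p : MvPolynomial ι ℂ)
    {z w : X → ι → ℂ} (hz : Continuous z) (hw : Continuous w) :
    Continuous fun x => dirDeriv p (z x) (w x) := by
  unfold dirDeriv
  refine continuous_finsetSum _ fun j _ => ?_
  exact ((MvPolynomial.continuous_eval _).comp hz).mul ((continuous_apply j).comp hw)

/-- The one-parameter group `exp (i θ H)`. -/
def evolution {E : Type*} [NormedAddCommGroup E] [InnerProductSpace ℂ E] [CompleteSpace E]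
    (H : selfAdjoint (E →L[ℂ] E)) (θ : ℝ) : E →L[ℂ] E :=
  NormedSpace.exp (θ • (Complex.I • H.1))

section

variable {E : Type*} [NormedAddCommGroup E] [InnerProductSpace ℂ E] [CompleteSpace E]
  (H : selfAdjoint (E →L[ℂ] E))

theorem evolution_zero : evolution H 0 = 1 := by simp [evolution]

theorem hasDerivAt_evolution (θ : ℝ) :
    HasDerivAt (evolution H) ((Complex.I • H.1) * evolution H θ) θ :=
  hasDerivAt_exp_smul_const' (𝕂 := ℝ) (Complex.I • H.1) θ

theorem continuous_evolution : Continuous (evolution H) :=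
  continuous_iff_continuousAt.2 fun θ => (hasDerivAt_evolution H θ).continuousAt

theorem norm_evolution (θ : ℝ) (x : E) : ‖evolution H θ x‖ = ‖x‖ := by
  have h : evolution H θ = (selfAdjoint.expUnitary (θ • H)).1 := by
    rw [selfAdjoint.expUnitary_coe, evolution, smul_comm, selfAdjoint.val_smul]
  have hu : evolution H θ ∈ unitary (E →L[ℂ] E) := h ▸ (selfAdjoint.expUnitary (θ • H)).2
  exact ContinuousLinearMap.norm_map_of_mem_unitary hu x

theorem hasDerivAt_evolution_apply (θ : ℝ) (x : E) :
    HasDerivAt (fun s => evolution H s x) (Complex.I • H.1 (evolution H θ x)) θ := by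
  have h := (((ContinuousLinearMap.apply ℂ E x).restrictScalars ℝ).hasFDerivAt
    (x := evolution H θ)).comp_hasDerivAt θ (hasDerivAt_evolution H θ)
  exact h.congr_deriv rfl

end

theorem hasDerivAt_coord {n : ℕ} {f : ℝ → EuclideanSpace ℂ (Fin n → Bool)}
    {f' : EuclideanSpace ℂ (Fin n → Bool)} {θ : ℝ} (h : HasDerivAt f f' θ) (j : Fin n → Bool) :
    HasDerivAt (fun s => f s j) (f' j) θ :=
  (((EuclideanSpace.proj j : EuclideanSpace ℂ (Fin n → Bool) →L[ℂ] ℂ).restrictScalars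
    ℝ).hasFDerivAt.comp_hasDerivAt θ h)

theorem continuous_coords {n : ℕ} {X : Type*} [TopologicalSpace X]
    {f : X → EuclideanSpace ℂ (Fin n → Bool)} (h : Continuous f) :
    Continuous fun x => (f x).ofLp :=
  (PiLp.continuous_ofLp 2 _).comp h

theorem dirDeriv_smul {ι : Type*} [Fintype ι] (p : MvPolynomial ι ℂ) (z w : ι → ℂ) (c : ℂ) :
    dirDeriv p z (c • w) = c * dirDeriv p z w := by
  simp only [dirDeriv, Finset.mul_sum, Pi.smul_apply, smul_eq_mul]
  exact Finset.sum_congr rfl fun j _ => by ring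

theorem dirDeriv_add {ι : Type*} [Fintype ι] (p : MvPolynomial ι ℂ) (z w w' : ι → ℂ) :
    dirDeriv p z (w + w') = dirDeriv p z w + dirDeriv p z w' := by
  simp only [dirDeriv, Pi.add_apply, mul_add, Finset.sum_add_distrib]

/-- `exp (i θ H)` as an isometry. -/
def evolutionIsometry {n : ℕ}
    (H : selfAdjoint (EuclideanSpace ℂ (Fin n → Bool) →L[ℂ] EuclideanSpace ℂ (Fin n → Bool)))
    (θ : ℝ) : EuclideanSpace ℂ (Fin n → Bool) ≃ₗᵢ[ℝ] EuclideanSpace ℂ (Fin n → Bool) :=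
  LinearIsometry.toLinearIsometryEquiv
    { toLinearMap := (evolution H θ).toLinearMap.restrictScalars ℝ
      norm_map' := norm_evolution H θ } rfl

/-- The Haar average of the derivative of a function along a one-parameter group of rotations
vanishes. -/
theorem integral_deriv_evolution {n : ℕ}
    (H : selfAdjoint (EuclideanSpace ℂ (Fin n → Bool) →L[ℂ] EuclideanSpace ℂ (Fin n → Bool)))
    {f f' : EuclideanSpace ℂ (Fin n → Bool) → ℂ} (hf : Continuous f) (hf' : Continuous f')
    (hder : ∀ x θ, HasDerivAt (fun s => f (evolution H s x)) (f' (evolution H θ x)) θ) :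
    ∫ ψ : PureState n, f' ψ.1 ∂(haar n) = 0 := by
  have hz : Continuous fun a : ℝ × PureState n => evolution H a.1 a.2.1 :=
    ((continuous_evolution H).comp continuous_fst).clm_apply
      (continuous_subtype_val.comp continuous_snd)
  have hF := hf.comp hz
  have hF' := hf'.comp hz
  obtain ⟨C, hC⟩ := ((isCompact_Icc (a := (-1 : ℝ)) (b := 1)).prod
    (isCompact_univ (X := PureState n))).exists_bound_of_continuousOn hF'.continuousOn
  have key := (hasDerivAt_integral_of_dominated_loc_of_deriv_le (μ := haar n)
    (F := fun θ (ψ : PureState n) => f (evolution H θ ψ.1))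
    (F' := fun θ (ψ : PureState n) => f' (evolution H θ ψ.1))
    (x₀ := (0 : ℝ)) (s := Set.Icc (-1) 1) (bound := fun _ => C)
    (Icc_mem_nhds (by norm_num) (by norm_num))
    (Filter.Eventually.of_forall fun θ =>
      (hF.comp (Continuous.prodMk_right θ)).aestronglyMeasurable)
    (integrable_haar (hF.comp (Continuous.prodMk_right 0)))
    (hF'.comp (Continuous.prodMk_right 0)).aestronglyMeasurable
    (ae_of_all _ fun ψ θ hθ => hC (θ, ψ) ⟨hθ, Set.mem_univ ψ⟩)
    (integrable_const C) (ae_of_all _ fun ψ θ _ => hder ψ.1 θ)).2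
  -- By rotation invariance the average does not depend on `θ`, so the derivative at `0`, computed
  -- under the integral, is zero.
  have hconst : ∀ θ, ∫ ψ : PureState n, f (evolution H θ ψ.1) ∂(haar n) =
      ∫ ψ : PureState n, f ψ.1 ∂(haar n) := by
    intro θ
    exact integral_haar_comp (evolutionIsometry H θ) (hf.comp continuous_subtype_val)
  simp only [hconst] at key
  have := key.unique (hasDerivAt_const _ _)
  simpa only [evolution_zero, one_apply_eq_self] using this

/-- The derivation of polynomials given by a self-adjoint operator is symmetric for the Haar
inner product. -/
theorem integral_dirDeriv_selfAdjoint {n : ℕ} (p q : MvPolynomial (Fin n → Bool) ℂ)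
    (H : selfAdjoint (EuclideanSpace ℂ (Fin n → Bool) →L[ℂ] EuclideanSpace ℂ (Fin n → Bool))) :
    ∫ ψ : PureState n, dirDeriv p ψ.1 (H.1 ψ.1) * star (MvPolynomial.eval ψ.1 q) ∂(haar n) =
      ∫ ψ : PureState n, MvPolynomial.eval ψ.1 p * star (dirDeriv q ψ.1 (H.1 ψ.1)) ∂(haar n) := by
  classical
  have hi : Continuous fun x : EuclideanSpace ℂ (Fin n → Bool) => x.ofLp :=
    continuous_coords continuous_id
  have hw : Continuous fun x : EuclideanSpace ℂ (Fin n → Bool) => (H.1 x).ofLp :=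
    continuous_coords H.1.continuous
  have hp (r : MvPolynomial (Fin n → Bool) ℂ) :
      Continuous fun x : EuclideanSpace ℂ (Fin n → Bool) => MvPolynomial.eval x r :=
    (MvPolynomial.continuous_eval r).comp hi
  have hd (r : MvPolynomial (Fin n → Bool) ℂ) := continuous_dirDeriv r hi hw
  have h1 := (hd p).mul (continuous_star.comp (hp q))
  have h2 := (hp p).mul (continuous_star.comp (hd q))
  -- Conjugation turns the factor `i` of the second derivative into `-i`, so the product rule gives
  -- `i` times the difference of the two integrands.
  have key := integral_deriv_evolution H
    (f := fun x => MvPolynomial.eval x p * star (MvPolynomial.eval x q))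
    (f' := fun x => Complex.I * (dirDeriv p x (H.1 x) * star (MvPolynomial.eval x q) -
        MvPolynomial.eval x p * star (dirDeriv q x (H.1 x))))
    ((hp p).mul (continuous_star.comp (hp q))) (continuous_const.mul (h1.sub h2)) (by
      intro x θ
      have hx := hasDerivAt_coord (hasDerivAt_evolution_apply H θ x)
      have := (hasDerivAt_eval p hx).mul (hasDerivAt_eval q hx).star
      refine this.congr_deriv ?_
      have hI (r : MvPolynomial (Fin n → Bool) ℂ) :
          dirDeriv r (evolution H θ x) (Complex.I • H.1 (evolution H θ x)).ofLp =
          Complex.I * dirDeriv r (evolution H θ x) (H.1 (evolution H θ x)) :=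
        dirDeriv_smul r _ _ _
      rw [hI, hI, star_mul', Complex.star_def, Complex.conj_I]
      ring)
  rw [integral_const_mul] at key
  have hsub := (mul_eq_zero.1 key).resolve_left Complex.I_ne_zero
  rw [integral_sub] at hsub
  · exact sub_eq_zero.1 hsub
  · exact integrable_haar (h1.comp continuous_subtype_val)
  · exact integrable_haar (h2.comp continuous_subtype_val)

/-- The derivation of polynomials given by an operator and that given by its adjoint are adjoint
for the Haar inner product. -/
theorem integral_dirDeriv {n : ℕ} (p q : MvPolynomial (Fin n → Bool) ℂ)
    (A : EuclideanSpace ℂ (Fin n → Bool) →L[ℂ] EuclideanSpace ℂ (Fin n → Bool)) :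
    ∫ ψ : PureState n, dirDeriv p ψ.1 (A ψ.1) * star (MvPolynomial.eval ψ.1 q) ∂(haar n) =
      ∫ ψ : PureState n, MvPolynomial.eval ψ.1 p * star (dirDeriv q ψ.1 (star A ψ.1))
        ∂(haar n) := by
  have hi : Continuous fun x : PureState n => x.1.ofLp := continuous_coords continuous_subtype_val
  have hw (B : EuclideanSpace ℂ (Fin n → Bool) →L[ℂ] EuclideanSpace ℂ (Fin n → Bool)) :
      Continuous fun x : PureState n => (B x.1).ofLp :=
    continuous_coords (B.continuous.comp continuous_subtype_val)
  have hp (r : MvPolynomial (Fin n → Bool) ℂ) :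
      Continuous fun x : PureState n => MvPolynomial.eval x.1 r :=
    (MvPolynomial.continuous_eval r).comp hi
  have hd (r : MvPolynomial (Fin n → Bool) ℂ)
      (B : EuclideanSpace ℂ (Fin n → Bool) →L[ℂ] EuclideanSpace ℂ (Fin n → Bool)) :=
    continuous_dirDeriv r hi (hw B)
  -- Both sides are complex linear in `A`, the right one because two conjugations cancel. Hence the
  -- self-adjoint case, applied to the real and imaginary parts, suffices.
  obtain ⟨R, J, hA⟩ : ∃ R J : selfAdjoint
      (EuclideanSpace ℂ (Fin n → Bool) →L[ℂ] EuclideanSpace ℂ (Fin n → Bool)),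
      A = R.1 + Complex.I • J.1 :=
    ⟨realPart A, imaginaryPart A, (realPart_add_I_smul_imaginaryPart A).symm⟩
  have hA' : star A = R.1 + (-Complex.I) • J.1 := by
    rw [hA, star_add (R := EuclideanSpace ℂ (Fin n → Bool) →L[ℂ] EuclideanSpace ℂ (Fin n → Bool)),
      star_smul, R.2.star_eq, J.2.star_eq, Complex.star_def, Complex.conj_I]
  have hl (r : MvPolynomial (Fin n → Bool) ℂ) (x : EuclideanSpace ℂ (Fin n → Bool)) (c : ℂ) :
      dirDeriv r x ((R.1 + c • J.1) x) = dirDeriv r x (R.1 x) + c * dirDeriv r x (J.1 x) := by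
    rw [← dirDeriv_smul, ← dirDeriv_add]
    rfl
  have h1 (x : PureState n) : dirDeriv p x.1 (A x.1) * star (MvPolynomial.eval x.1 q) =
      dirDeriv p x.1 (R.1 x.1) * star (MvPolynomial.eval x.1 q) +
      Complex.I * (dirDeriv p x.1 (J.1 x.1) * star (MvPolynomial.eval x.1 q)) := by
    rw [hA, hl]; ring
  have h2 (x : PureState n) : MvPolynomial.eval x.1 p * star (dirDeriv q x.1 (star A x.1)) =
      MvPolynomial.eval x.1 p * star (dirDeriv q x.1 (R.1 x.1)) +
      Complex.I * (MvPolynomial.eval x.1 p * star (dirDeriv q x.1 (J.1 x.1))) := by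
    rw [hA', hl, star_add, star_mul', Complex.star_def, map_neg, Complex.conj_I]; ring
  simp only [h1, h2]
  have i1 (B : EuclideanSpace ℂ (Fin n → Bool) →L[ℂ] EuclideanSpace ℂ (Fin n → Bool)) :=
    integrable_haar ((hd p B).mul (continuous_star.comp (hp q)))
  have i2 (B : EuclideanSpace ℂ (Fin n → Bool) →L[ℂ] EuclideanSpace ℂ (Fin n → Bool)) :=
    integrable_haar ((hp p).mul (continuous_star.comp (hd q B)))
  have e1 := integral_add (i1 R.1) ((i1 J.1).const_mul Complex.I)
  have e2 := integral_add (i2 R.1) ((i2 J.1).const_mul Complex.I)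
  refine e1.trans (Eq.trans ?_ e2.symm)
  have s1 := integral_dirDeriv_selfAdjoint p q R
  have s2 := integral_dirDeriv_selfAdjoint p q J
  rw [integral_const_mul, integral_const_mul]
  exact congrArg₂ (fun a b => a + Complex.I * b) s1 s2

/-! ### Haar inner products of polynomials -/

theorem continuous_eval_state {n : ℕ} (p : MvPolynomial (Fin n → Bool) ℂ) :
    Continuous fun ψ : PureState n => MvPolynomial.eval ψ.1 p :=
  (MvPolynomial.continuous_eval p).comp (continuous_coords continuous_subtype_val)

/-- The inner product of two polynomial functions on the sphere. -/
def haarInner {n : ℕ} (p q : MvPolynomial (Fin n → Bool) ℂ) : ℂ :=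
  ∫ ψ : PureState n, MvPolynomial.eval ψ.1 p * star (MvPolynomial.eval ψ.1 q) ∂(haar n)

theorem integrable_haarInner {n : ℕ} (p q : MvPolynomial (Fin n → Bool) ℂ) :
    Integrable (fun ψ : PureState n => MvPolynomial.eval ψ.1 p * star (MvPolynomial.eval ψ.1 q))
      (haar n) :=
  integrable_haar ((continuous_eval_state p).mul (continuous_star.comp (continuous_eval_state q)))

/-- The mean square of a polynomial function on the sphere. -/
def haarSq {n : ℕ} (p : MvPolynomial (Fin n → Bool) ℂ) : ℝ :=
  ∫ ψ : PureState n, ‖MvPolynomial.eval ψ.1 p‖ ^ 2 ∂(haar n)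

theorem haarSq_nonneg {n : ℕ} (p : MvPolynomial (Fin n → Bool) ℂ) : 0 ≤ haarSq p :=
  integral_nonneg fun _ => sq_nonneg _

theorem haarInner_self {n : ℕ} (p : MvPolynomial (Fin n → Bool) ℂ) :
    haarInner p p = (haarSq p : ℂ) := by
  unfold haarInner haarSq
  rw [← integral_complex_ofReal]
  refine integral_congr_ae (ae_of_all _ fun ψ => ?_)
  simp only [Complex.star_def, Complex.mul_conj, Complex.normSq_eq_norm_sq]

theorem haarInner_conj {n : ℕ} (p q : MvPolynomial (Fin n → Bool) ℂ) :
    star (haarInner p q) = haarInner q p := by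
  unfold haarInner
  rw [Complex.star_def, ← integral_conj]
  refine integral_congr_ae (ae_of_all _ fun ψ => ?_)
  simp [mul_comm]

theorem haarInner_add_right {n : ℕ} (p q r : MvPolynomial (Fin n → Bool) ℂ) :
    haarInner p (q + r) = haarInner p q + haarInner p r := by
  unfold haarInner
  rw [← integral_add (integrable_haarInner p q) (integrable_haarInner p r)]
  refine integral_congr_ae (ae_of_all _ fun ψ => ?_)
  simp [mul_add]

theorem haarInner_smul_right {n : ℕ} (p q : MvPolynomial (Fin n → Bool) ℂ) (c : ℂ) :
    haarInner p (c • q) = star c * haarInner p q := by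
  unfold haarInner
  rw [← integral_const_mul]
  refine integral_congr_ae (ae_of_all _ fun ψ => ?_)
  simp only [MvPolynomial.smul_eval, star_mul']
  ring

/-- The linear form with coefficients `c`. -/
def linForm {ι : Type*} [Fintype ι] (c : ι → ℂ) : MvPolynomial ι ℂ :=
  ∑ k, c k • MvPolynomial.X k

/-- The derivative along the vector conjugate to `c`. -/
def conjDeriv {ι : Type*} [Fintype ι] (c : ι → ℂ) (p : MvPolynomial ι ℂ) : MvPolynomial ι ℂ :=
  ∑ k, star (c k) • MvPolynomial.pderiv k p

theorem isHomogeneous_linForm {ι : Type*} [Fintype ι] (c : ι → ℂ) :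
    (linForm c).IsHomogeneous 1 := by
  refine MvPolynomial.IsHomogeneous.sum _ _ _ fun k _ => ?_
  rw [MvPolynomial.smul_eq_C_mul]
  simpa using (MvPolynomial.isHomogeneous_C ι (c k)).mul (MvPolynomial.isHomogeneous_X ℂ k)

theorem isHomogeneous_conjDeriv {ι : Type*} [Fintype ι] (c : ι → ℂ) {p : MvPolynomial ι ℂ} {t : ℕ}
    (hp : p.IsHomogeneous t) : (conjDeriv c p).IsHomogeneous (t - 1) := by
  refine MvPolynomial.IsHomogeneous.sum _ _ _ fun k _ => ?_
  rw [MvPolynomial.smul_eq_C_mul]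
  simpa using (MvPolynomial.isHomogeneous_C ι (star (c k))).mul (hp.pderiv (i := k))

theorem eval_linForm {ι : Type*} [Fintype ι] (c z : ι → ℂ) :
    MvPolynomial.eval z (linForm c) = ∑ k, c k * z k := by
  simp [linForm, MvPolynomial.smul_eval]

/-- The Leibniz rule, read as a canonical commutation relation: the commutator of the derivative and
the multiplication is the scalar `‖c‖²`. -/
theorem conjDeriv_linForm_mul {ι : Type*} [Fintype ι] (c : ι → ℂ) (p : MvPolynomial ι ℂ) :
    conjDeriv c (linForm c * p) =
      ((∑ k, ‖c k‖ ^ 2 : ℝ) : ℂ) • p + linForm c * conjDeriv c p := by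
  classical
  have h (k : ι) : MvPolynomial.pderiv k (linForm c) = MvPolynomial.C (c k) := by
    simp [linForm, MvPolynomial.pderiv_X, Pi.single_apply, MvPolynomial.smul_eq_C_mul]
  simp only [conjDeriv, Derivation.leibniz, h, smul_add, Finset.sum_add_distrib, Finset.mul_sum]
  rw [add_comm]
  congr 1
  · push_cast
    rw [Finset.sum_smul]
    refine Finset.sum_congr rfl fun k _ => ?_
    rw [smul_eq_mul, mul_comm, ← MvPolynomial.smul_eq_C_mul, smul_smul, Complex.star_def,
      Complex.conj_mul']
  · refine Finset.sum_congr rfl fun k _ => ?_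
    rw [smul_eq_mul, mul_smul_comm]

/-- Up to a factor, multiplication by a linear form is adjoint to a derivative. -/
theorem haarInner_linForm_mul {n t : ℕ} (c : (Fin n → Bool) → ℂ)
    {u : MvPolynomial (Fin n → Bool) ℂ} (hu : u.IsHomogeneous t)
    (q : MvPolynomial (Fin n → Bool) ℂ) :
    ((2 ^ n + t : ℕ) : ℂ) * haarInner (linForm c * u) q = haarInner u (conjDeriv c q) := by
  classical
  -- The operator `|e j⟩⟨v|` sends `ψ` to the value of the linear form times `e j`; its adjoint
  -- sends `ψ` to `ψ j` times `v`. Applied to `X j * u` and summed over `j`, the left side is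
  -- handled by Euler's identity and the right side by the normalisation of `ψ`.
  let v : EuclideanSpace ℂ (Fin n → Bool) := WithLp.toLp 2 (star c)
  let e (j : Fin n → Bool) : EuclideanSpace ℂ (Fin n → Bool) := EuclideanSpace.single j 1
  have key (j : Fin n → Bool) :=
    integral_dirDeriv (MvPolynomial.X j * u) q (InnerProductSpace.rankOne ℂ (e j) v)
  have h1 (j : Fin n → Bool) (ψ : PureState n) :
      dirDeriv (MvPolynomial.X j * u) ψ.1 (InnerProductSpace.rankOne ℂ (e j) v ψ.1) *
        star (MvPolynomial.eval ψ.1 q) =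
      MvPolynomial.eval ψ.1 (linForm c * MvPolynomial.pderiv j (MvPolynomial.X j * u)) *
        star (MvPolynomial.eval ψ.1 q) := by
    congr 1
    rw [dirDeriv, Finset.sum_eq_single j]
    · simp only [InnerProductSpace.rankOne_apply, e, v, map_mul, eval_linForm]
      rw [mul_comm]
      congr 1
      simp [PiLp.inner_apply, mul_comm]
    · intro b _ hb
      simp [e, hb]
    · simp
  have h2 (j : Fin n → Bool) (ψ : PureState n) :
      MvPolynomial.eval ψ.1 (MvPolynomial.X j * u) *
        star (dirDeriv q ψ.1 (star (InnerProductSpace.rankOne ℂ (e j) v) ψ.1)) =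
      (ψ.1 j * star (ψ.1 j)) *
        (MvPolynomial.eval ψ.1 u * star (MvPolynomial.eval ψ.1 (conjDeriv c q))) := by
    have : dirDeriv q ψ.1 (star (InnerProductSpace.rankOne ℂ (e j) v) ψ.1) =
        ψ.1 j * MvPolynomial.eval ψ.1 (conjDeriv c q) := by
      rw [ContinuousLinearMap.star_eq_adjoint, InnerProductSpace.adjoint_rankOne]
      simp only [InnerProductSpace.rankOne_apply, dirDeriv, conjDeriv, map_sum,
        MvPolynomial.smul_eval, Finset.mul_sum, e, v]
      refine Finset.sum_congr rfl fun k _ => ?_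
      simp [EuclideanSpace.inner_single_left]
      ring
    rw [this, star_mul', map_mul, MvPolynomial.eval_X]
    ring
  simp only [h1, h2] at key
  have hsum := Finset.sum_congr (rfl : Finset.univ = Finset.univ) fun j _ => key j
  have hcard : Fintype.card (Fin n → Bool) = 2 ^ n := by simp
  -- Each of the `2 ^ n` variables contributes one `u` from the derivative of `X j`, and Euler's
  -- identity contributes `t` more.
  have heuler : ∑ j, MvPolynomial.pderiv j (MvPolynomial.X j * u) = ((2 ^ n + t : ℕ) : ℂ) • u := by
    simp only [Derivation.leibniz, MvPolynomial.pderiv_X_self, smul_eq_mul, mul_one,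
      Finset.sum_add_distrib, hu.sum_X_mul_pderiv]
    rw [Finset.sum_const, Finset.card_univ, hcard, add_comm, ← add_smul, Nat.cast_smul_eq_nsmul]
  have hcoord (j : Fin n → Bool) : Continuous fun ψ : PureState n => ψ.1 j :=
    (continuous_apply j).comp (continuous_coords continuous_subtype_val)
  have hint (j : Fin n → Bool) : Integrable (fun ψ : PureState n => (ψ.1 j * star (ψ.1 j)) *
      (MvPolynomial.eval ψ.1 u * star (MvPolynomial.eval ψ.1 (conjDeriv c q)))) (haar n) :=
    integrable_haar (((hcoord j).mul (continuous_star.comp (hcoord j))).mul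
      ((continuous_eval_state u).mul (continuous_star.comp (continuous_eval_state _))))
  rw [← integral_finsetSum _ fun j _ => integrable_haarInner _ _,
    ← integral_finsetSum _ fun j _ => hint j] at hsum
  unfold haarInner
  rw [← integral_const_mul]
  refine Eq.trans (integral_congr_ae (ae_of_all _ fun ψ => ?_))
    (hsum.trans (integral_congr_ae (ae_of_all _ fun ψ => ?_)))
  · simp only
    rw [← Finset.sum_mul, ← map_sum, ← Finset.mul_sum, heuler, map_mul, map_mul,
      MvPolynomial.smul_eval]
    ring
  · simp only
    rw [← Finset.sum_mul]
    have : ∑ j, ψ.1 j * star (ψ.1 j) = 1 := by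
      have h : ‖ψ.1‖ ^ 2 = 1 := by simp
      rw [EuclideanSpace.norm_sq_eq] at h
      simp only [Complex.star_def, Complex.mul_conj']
      exact_mod_cast h
    rw [this, one_mul]

/-- Multiplication by a linear form increases the mean square by at least the factor that it has
for constants, up to a correction for the degree. -/
theorem le_haarSq_linForm_mul {n t : ℕ} (c : (Fin n → Bool) → ℂ)
    {p : MvPolynomial (Fin n → Bool) ℂ} (hp : p.IsHomogeneous t) :
    (∑ k, ‖c k‖ ^ 2) * haarSq p ≤ (2 ^ n + t) * haarSq (linForm c * p) := by
  have h1 := haarInner_linForm_mul c hp (linForm c * p)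
  rw [conjDeriv_linForm_mul, haarInner_add_right, haarInner_smul_right, haarInner_self,
    haarInner_self] at h1
  -- A second use of adjointness, now in degree `t - 1`: a positive multiple of this cross term is
  -- the mean square of `conjDeriv c p`. Truncated subtraction is harmless, since for `t = 0` the
  -- derivative vanishes.
  have h2 : 0 ≤ (haarInner p (linForm c * conjDeriv c p)).re := by
    have h3 := haarInner_linForm_mul c (isHomogeneous_conjDeriv c hp) p
    rw [haarInner_self, ← haarInner_conj] at h3
    have h4 := congrArg Complex.re h3
    rw [← Complex.ofReal_natCast, Complex.re_ofReal_mul, Complex.ofReal_re, Complex.star_def,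
      Complex.conj_re] at h4
    have h5 : (0 : ℝ) < ((2 ^ n + (t - 1) : ℕ) : ℝ) := by positivity
    exact (mul_nonneg_iff_of_pos_left h5).1 (h4 ▸ haarSq_nonneg _)
  have h3 := congrArg Complex.re h1
  rw [← Complex.ofReal_natCast, Complex.re_ofReal_mul, Complex.ofReal_re, Complex.add_re,
    Complex.star_def, Complex.conj_ofReal, Complex.re_ofReal_mul, Complex.ofReal_re] at h3
  push_cast at h3
  linarith

/-! ### Haar random states against the maximally mixed state -/

theorem exists_eq_conjTranspose_mul_self {ι : Type*} [Fintype ι] {M : Matrix ι ι ℂ}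
    (hM : M.PosSemidef) : ∃ B : Matrix ι ι ℂ, M = B.conjTranspose * B := by
  classical
  open scoped MatrixOrder in
  exact CStarAlgebra.nonneg_iff_eq_star_mul_self.1 (Matrix.nonneg_iff_posSemidef.2 hM)

/-- Outcome probabilities on pure states become sums of squared linear forms, one for each row of
`B`; this is what brings the likelihoods into reach of `le_haarSq_linForm_mul`. -/
theorem trace_conjTranspose_mul_proj {n : ℕ} (B : QMat n) (ψ : PureState n) :
    ((B.conjTranspose * B) * proj ψ).trace =
      ((∑ i, ‖MvPolynomial.eval ψ.1 (linForm (B i))‖ ^ 2 : ℝ) : ℂ) := by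
  have h (i : Fin n → Bool) : ((‖MvPolynomial.eval ψ.1 (linForm (B i))‖ ^ 2 : ℝ) : ℂ) =
      ∑ x, ∑ y, star (B i x) * B i y * (ψ.1 y * star (ψ.1 x)) := by
    push_cast
    rw [← Complex.conj_mul', eval_linForm, map_sum, Finset.sum_mul_sum]
    refine Finset.sum_congr rfl fun x _ => Finset.sum_congr rfl fun y _ => ?_
    simp only [map_mul, Complex.star_def]
    ring
  rw [Complex.ofReal_sum]
  simp only [h]
  simp only [Matrix.trace, Matrix.diag_apply, Matrix.mul_apply, Matrix.conjTranspose_apply, proj,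
    Finset.sum_mul]
  rw [Finset.sum_comm (s := Finset.univ (α := Fin n → Bool))]
  refine Eq.trans (Finset.sum_congr rfl fun x _ => Finset.sum_comm) ?_
  rw [Finset.sum_comm]
  refine Finset.sum_congr rfl fun i _ => Finset.sum_comm

theorem trace_conjTranspose_mul_self {n : ℕ} (B : QMat n) :
    (B.conjTranspose * B).trace = ((∑ i, ∑ k, ‖B i k‖ ^ 2 : ℝ) : ℂ) := by
  push_cast
  simp only [Matrix.trace, Matrix.diag_apply, Matrix.mul_apply, Matrix.conjTranspose_apply,
    Complex.star_def, Complex.conj_mul']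
  exact Finset.sum_comm

theorem trace_mul_maxMixed {n : ℕ} (M : QMat n) :
    (M * maxMixed n).trace.re = M.trace.re / 2 ^ n := by
  rw [maxMixed, Matrix.mul_smul, mul_one, Matrix.trace_smul, smul_eq_mul, mul_comm,
    ← div_eq_mul_inv]
  have : ((2 : ℂ) ^ n) = (((2 : ℝ) ^ n : ℝ) : ℂ) := by push_cast; rfl
  rw [this, Complex.div_ofReal_re]

theorem continuous_proj {n : ℕ} : Continuous (proj : PureState n → QMat n) := by
  have h (x : Fin n → Bool) : Continuous fun ψ : PureState n => ψ.1 x :=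
    (continuous_apply x).comp (continuous_coords continuous_subtype_val)
  exact continuous_pi fun x => continuous_pi fun y =>
    (h x).mul (continuous_star.comp (h y))

namespace MemorylessAlgorithm

variable {n : ℕ} (W : MemorylessAlgorithm n)

theorem continuous_acceptFrom (t : ℕ) (h : List W.Out) :
    Continuous fun ρ : QMat n => W.acceptFrom ρ t h := by
  induction t generalizing h with
  | zero => exact continuous_const
  | succ t ih =>
    refine continuous_finsetSum _ fun o _ => Continuous.mul ?_ (ih _)
    exact Complex.continuous_re.comp
      (Continuous.matrix_trace (continuous_const.matrix_mul continuous_id))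

/-- A matrix on which all effects have nonnegative weight. -/
def _root_.MemorylessPRS.IsPositive (ρ : QMat n) : Prop :=
  ∀ M : QMat n, M.PosSemidef → 0 ≤ (M * ρ).trace.re

theorem sum_trace_povm (h : List W.Out) (ρ : QMat n) :
    ∑ o, (W.povm h o * ρ).trace.re = ρ.trace.re := by
  rw [← Complex.re_sum, ← Matrix.trace_sum, ← Finset.sum_mul, W.sum_eq_one, one_mul]

theorem acceptFrom_mem_Icc {ρ : QMat n} (hρ : IsPositive ρ) (h1 : ρ.trace.re = 1) (t : ℕ)
    (h : List W.Out) : W.acceptFrom ρ t h ∈ Set.Icc (0 : ℝ) 1 := by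
  induction t generalizing h with
  | zero => simp only [acceptFrom]; split_ifs <;> simp
  | succ t ih =>
    have hp (o : W.Out) := hρ _ (W.posSemidef h o)
    refine ⟨Finset.sum_nonneg fun o _ => mul_nonneg (hp o) (ih _).1, ?_⟩
    calc W.acceptFrom ρ (t + 1) h ≤ ∑ o, (W.povm h o * ρ).trace.re :=
          Finset.sum_le_sum fun o _ => mul_le_of_le_one_right (hp o) (ih _).2
      _ = 1 := by rw [sum_trace_povm, h1]

theorem _root_.MemorylessPRS.isPositive_proj (ψ : PureState n) : IsPositive (proj ψ) := by
  intro M hM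
  obtain ⟨B, rfl⟩ := exists_eq_conjTranspose_mul_self hM
  rw [trace_conjTranspose_mul_proj, Complex.ofReal_re]
  positivity

theorem _root_.MemorylessPRS.trace_proj (ψ : PureState n) : (proj ψ).trace = 1 := by
  have h : ‖ψ.1‖ ^ 2 = 1 := by simp
  rw [EuclideanSpace.norm_sq_eq] at h
  simp only [Matrix.trace, Matrix.diag_apply, proj, Complex.star_def, Complex.mul_conj']
  exact_mod_cast h

theorem _root_.MemorylessPRS.isPositive_maxMixed : IsPositive (maxMixed n) := by
  intro M hM
  rw [trace_mul_maxMixed]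
  exact div_nonneg (Complex.le_def.1 hM.trace_nonneg).1 (by positivity)

theorem _root_.MemorylessPRS.trace_maxMixed : (maxMixed n).trace.re = 1 := by
  have := trace_mul_maxMixed (1 : QMat n)
  rw [one_mul, Matrix.trace_one, Complex.natCast_re] at this
  rw [this]
  simp

/-- The product of `2^n / (2^n + s + i)` over `i < t`. -/
def _root_.MemorylessPRS.collisionFactor (n s t : ℕ) : ℝ :=
  ∏ i ∈ Finset.range t, (2 ^ n / (2 ^ n + s + i) : ℝ)

/-- The factor with `i = 0` is split off, not the last one, because the induction over the rounds
measures the next copy at once and continues in degree `s + 1`. -/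
theorem _root_.MemorylessPRS.collisionFactor_succ (n s t : ℕ) : collisionFactor n s (t + 1) =
    collisionFactor n (s + 1) t * (2 ^ n / (2 ^ n + s)) := by
  simp only [collisionFactor, Finset.prod_range_succ']
  simp [add_assoc, add_comm, add_left_comm]

theorem _root_.MemorylessPRS.collisionFactor_nonneg (n s t : ℕ) : 0 ≤ collisionFactor n s t :=
  Finset.prod_nonneg fun _ _ => by positivity

/-- The factor with index `t` is at least `1 - t / 2 ^ n` and the product before it is at most `1`,
so it costs at most `t / 2 ^ n`. The increment of the square, `2 * t + 1`, covers this. -/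
theorem _root_.MemorylessPRS.collisionFactor_ge (n t : ℕ) :
    1 - (t : ℝ) ^ 2 / 2 ^ n ≤ collisionFactor n 0 t ∧ collisionFactor n 0 t ≤ 1 := by
  induction t with
  | zero => simp [collisionFactor]
  | succ t ih =>
    have h0 := collisionFactor_nonneg n 0 t
    have hd : (0 : ℝ) < 2 ^ n := by positivity
    have hs : collisionFactor n 0 (t + 1) = collisionFactor n 0 t * (2 ^ n / (2 ^ n + t)) := by
      rw [collisionFactor, Finset.prod_range_succ, ← collisionFactor, Nat.cast_zero, add_zero]
    have hle : (2 ^ n / (2 ^ n + t) : ℝ) ≤ 1 := by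
      rw [div_le_one (by positivity)]; simp
    have hge : 1 - t / 2 ^ n ≤ (2 ^ n / (2 ^ n + t) : ℝ) := by
      rw [le_div_iff₀ (by positivity)]
      have : (1 - (t : ℝ) / 2 ^ n) * (2 ^ n + t) = 2 ^ n - t ^ 2 / 2 ^ n := by
        field_simp; ring
      rw [this]
      have : (0 : ℝ) ≤ t ^ 2 / 2 ^ n := by positivity
      linarith
    rw [hs]
    refine ⟨?_, mul_le_one₀ ih.2 (by positivity) hle⟩
    have h1 := mul_le_mul_of_nonneg_left hge h0
    have h2 : collisionFactor n 0 t * (t / 2 ^ n) ≤ t / 2 ^ n :=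
      mul_le_of_le_one_left (by positivity) ih.2
    have h3 : ((t + 1 : ℕ) : ℝ) ^ 2 / 2 ^ n =
        (t : ℝ) ^ 2 / 2 ^ n + t / 2 ^ n + (t + 1) / 2 ^ n := by
      push_cast; ring
    have h4 : (0 : ℝ) ≤ (t + 1) / 2 ^ n := by positivity
    rw [h3]
    nlinarith [ih.1]

/-- Conditioned on the outcomes so far, whose likelihood is the square of a homogeneous
polynomial, Haar random states are accepted at least about as often as the maximally mixed
state. -/
theorem le_integral_acceptFrom (t s : ℕ) (h : List W.Out) {p : MvPolynomial (Fin n → Bool) ℂ}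
    (hp : p.IsHomogeneous s) :
    collisionFactor n s t * W.acceptFrom (maxMixed n) t h * haarSq p ≤
      ∫ ψ : PureState n, ‖MvPolynomial.eval ψ.1 p‖ ^ 2 * W.acceptFrom (proj ψ) t h ∂(haar n) := by
  induction t generalizing s h p with
  | zero =>
    simp only [acceptFrom, collisionFactor, Finset.range_zero, Finset.prod_empty, one_mul]
    rw [integral_mul_const, mul_comm]
    rfl
  | succ t ih =>
    -- Every outcome is refined into the rows of `B o`. Each row multiplies `p` by a linear form, so
    -- each summand is again the square of a homogeneous polynomial, of degree `s + 1`, and the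
    -- induction hypothesis applies to it separately.
    choose B hB using fun o => exists_eq_conjTranspose_mul_self (W.posSemidef h o)
    have hint (o : W.Out) (i : Fin n → Bool) : Integrable (fun ψ : PureState n =>
        ‖MvPolynomial.eval ψ.1 (linForm (B o i) * p)‖ ^ 2 * W.acceptFrom (proj ψ) t (o :: h))
        (haar n) :=
      integrable_haar (((continuous_eval_state _).norm.pow 2).mul
        ((W.continuous_acceptFrom t _).comp continuous_proj))
    have hexp : ∫ ψ : PureState n, ‖MvPolynomial.eval ψ.1 p‖ ^ 2 *
          W.acceptFrom (proj ψ) (t + 1) h ∂(haar n) =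
        ∑ o, ∑ i, ∫ ψ : PureState n, ‖MvPolynomial.eval ψ.1 (linForm (B o i) * p)‖ ^ 2 *
          W.acceptFrom (proj ψ) t (o :: h) ∂(haar n) := by
      simp only [← integral_finsetSum _ fun i _ => hint _ i]
      rw [← integral_finsetSum _ fun o _ => integrable_finsetSum _ fun i _ => hint o i]
      refine integral_congr_ae (ae_of_all _ fun ψ => ?_)
      simp only [acceptFrom, Finset.mul_sum]
      refine Finset.sum_congr rfl fun o _ => ?_
      rw [hB o, trace_conjTranspose_mul_proj, Complex.ofReal_re, Finset.sum_mul, Finset.mul_sum]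
      refine Finset.sum_congr rfl fun i _ => ?_
      rw [map_mul, norm_mul]
      ring
    rw [hexp]
    have hmix : W.acceptFrom (maxMixed n) (t + 1) h = ∑ o, ∑ i,
        (∑ k, ‖B o i k‖ ^ 2) / 2 ^ n * W.acceptFrom (maxMixed n) t (o :: h) := by
      simp only [acceptFrom]
      refine Finset.sum_congr rfl fun o _ => ?_
      rw [hB o, trace_mul_maxMixed, trace_conjTranspose_mul_self, Complex.ofReal_re,
        Finset.sum_div, Finset.sum_mul]
    rw [hmix, Finset.mul_sum, Finset.sum_mul]
    refine Finset.sum_le_sum fun o _ => ?_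
    rw [Finset.mul_sum, Finset.sum_mul]
    refine Finset.sum_le_sum fun i _ => ?_
    have hhom : (linForm (B o i) * p).IsHomogeneous (s + 1) := by
      rw [add_comm]; exact (isHomogeneous_linForm _).mul hp
    refine le_trans ?_ (ih (s + 1) (o :: h) hhom)
    -- The weight of row `i` is `‖B o i‖² / 2 ^ n` in the maximally mixed state and at least `‖B o
    -- i‖² / (2 ^ n + s)` relative to `haarSq p`; their ratio is the factor split off from
    -- `collisionFactor`.
    have hq := le_haarSq_linForm_mul (B o i) hp
    have hd : (0 : ℝ) < 2 ^ n + s := by positivity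
    have ha := (W.acceptFrom_mem_Icc isPositive_maxMixed trace_maxMixed t (o :: h)).1
    have hc := mul_nonneg (collisionFactor_nonneg n (s + 1) t) ha
    rw [collisionFactor_succ]
    calc _ = collisionFactor n (s + 1) t * W.acceptFrom (maxMixed n) t (o :: h) *
          (((∑ k, ‖B o i k‖ ^ 2) * haarSq p) / (2 ^ n + s)) := by
            field_simp
      _ ≤ _ := mul_le_mul_of_nonneg_left ((div_le_iff₀ hd).2 (by linarith)) hc

theorem integrable_acceptProb {Γ : QMat n → QMat n} (hΓ : Continuous Γ) :
    Integrable (fun ψ => W.acceptProb (Γ (proj ψ))) (haar n) :=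
  integrable_haar ((W.continuous_acceptFrom _ _).comp (hΓ.comp continuous_proj))

/-- The case `p = 1` of the induction, with no outcomes recorded; since acceptance probabilities are
at most `1`, the multiplicative loss becomes an additive one. -/
theorem le_haarProb_id :
    W.acceptProb (maxMixed n) - (W.copies : ℝ) ^ 2 / 2 ^ n ≤ W.haarProb id := by
  have h := W.le_integral_acceptFrom W.copies 0 [] (MvPolynomial.isHomogeneous_one (Fin n → Bool) ℂ)
  simp only [haarSq, map_one, norm_one, one_pow, one_mul, integral_const, probReal_univ,
    smul_eq_mul, mul_one] at h
  have ha := W.acceptFrom_mem_Icc isPositive_maxMixed trace_maxMixed W.copies []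
  have hc := (collisionFactor_ge n W.copies).1
  have h1 := mul_le_mul_of_nonneg_right hc ha.1
  have h2 : (W.copies : ℝ) ^ 2 / 2 ^ n * W.acceptFrom (maxMixed n) W.copies [] ≤
      (W.copies : ℝ) ^ 2 / 2 ^ n := mul_le_of_le_one_right (by positivity) ha.2
  change W.acceptFrom (maxMixed n) W.copies [] - _ ≤
    ∫ ψ, W.acceptFrom (proj ψ) W.copies [] ∂(haar n)
  linarith

/-- The algorithm with the opposite decision. -/
def compl : MemorylessAlgorithm n where
  copies := W.copies
  Out := W.Out
  povm := W.povm
  posSemidef := W.posSemidef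
  sum_eq_one := W.sum_eq_one
  accept h := !W.accept h

theorem acceptFrom_compl {ρ : QMat n} (h1 : ρ.trace.re = 1) (t : ℕ) (h : List W.Out) :
    W.compl.acceptFrom ρ t h = 1 - W.acceptFrom ρ t h := by
  induction t generalizing h with
  | zero =>
    change (if (!W.accept h) = true then (1 : ℝ) else 0) = 1 - if W.accept h = true then 1 else 0
    by_cases ha : W.accept h = true <;> simp [ha]
  | succ t ih =>
    have hs := W.sum_trace_povm h ρ
    rw [h1] at hs
    change ∑ o : W.Out, (W.povm h o * ρ).trace.re * W.compl.acceptFrom ρ t (o :: h) =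
      1 - ∑ o, (W.povm h o * ρ).trace.re * W.acceptFrom ρ t (o :: h)
    rw [← hs, ← Finset.sum_sub_distrib]
    refine Finset.sum_congr rfl fun o _ => ?_
    rw [← mul_one_sub]
    exact congrArg _ (ih (o :: h))

/-- The one-sided bound for the algorithm with the opposite decision supplies the other side. -/
theorem abs_haarProb_id_sub_le :
    |W.haarProb id - W.acceptProb (maxMixed n)| ≤ (W.copies : ℝ) ^ 2 / 2 ^ n := by
  have h1 := W.le_haarProb_id
  have h2 := W.compl.le_haarProb_id
  have h3 : W.compl.acceptProb (maxMixed n) = 1 - W.acceptProb (maxMixed n) :=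
    W.acceptFrom_compl trace_maxMixed _ _
  have h4 : W.compl.haarProb id = 1 - W.haarProb id := by
    have (ψ : PureState n) : W.compl.acceptProb (id (proj ψ)) = 1 - W.acceptProb (id (proj ψ)) :=
      W.acceptFrom_compl (by simp [trace_proj]) _ _
    simp only [haarProb, this]
    rw [integral_sub (integrable_const _) (W.integrable_acceptProb continuous_id)]
    simp
  rw [h3, h4] at h2
  change _ - (W.copies : ℝ) ^ 2 / 2 ^ n ≤ _ at h2
  rw [abs_le]
  constructor <;> linarith

end MemorylessAlgorithm

/-! ### Noise as part of the measurement -/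

/-- The adjoint of the channel with Kraus operators `E`. -/
def krausAdjoint {n r : ℕ} (E : Fin r → QMat n) (M : QMat n) : QMat n :=
  ∑ i, (E i).conjTranspose * M * E i

theorem posSemidef_krausAdjoint {n r : ℕ} (E : Fin r → QMat n) {M : QMat n} (hM : M.PosSemidef) :
    (krausAdjoint E M).PosSemidef :=
  Matrix.posSemidef_sum _ fun i _ => hM.conjTranspose_mul_mul_same (E i)

/-- Passage to the Heisenberg picture, by cyclicity of the trace: measuring after the noise is
measuring another POVM without noise. -/
theorem trace_krausAdjoint_mul {n r : ℕ} (E : Fin r → QMat n) (M ρ : QMat n) :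
    (krausAdjoint E M * ρ).trace = (M * ∑ i, E i * ρ * (E i).conjTranspose).trace := by
  simp only [krausAdjoint, Finset.sum_mul, Finset.mul_sum, Matrix.trace_sum]
  refine Finset.sum_congr rfl fun i _ => ?_
  rw [Matrix.mul_assoc, Matrix.mul_assoc, Matrix.trace_mul_comm]
  simp only [Matrix.mul_assoc]

theorem krausAdjoint_sum {n r : ℕ} (E : Fin r → QMat n) {ι : Type*} (s : Finset ι)
    (M : ι → QMat n) : krausAdjoint E (∑ o ∈ s, M o) = ∑ o ∈ s, krausAdjoint E (M o) := by
  simp only [krausAdjoint, Finset.mul_sum, Finset.sum_mul]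
  exact Finset.sum_comm

section

variable {n : ℕ} {Γ : QMat n → QMat n}

theorem IsChannel.continuous (hΓ : IsChannel Γ) : Continuous Γ := by
  obtain ⟨r, E, -, hE⟩ := hΓ
  rw [funext hE]
  exact continuous_finsetSum _ fun i _ =>
    (continuous_const.matrix_mul continuous_id).matrix_mul continuous_const

theorem IsChannel.isPositive (hΓ : IsChannel Γ) {ρ : QMat n} (hρ : IsPositive ρ) :
    IsPositive (Γ ρ) := by
  obtain ⟨r, E, -, hE⟩ := hΓ
  intro M hM
  rw [hE, ← trace_krausAdjoint_mul]
  exact hρ _ (posSemidef_krausAdjoint E hM)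

theorem IsChannel.trace_eq (hΓ : IsChannel Γ) (ρ : QMat n) : (Γ ρ).trace = ρ.trace := by
  obtain ⟨r, E, h1, hE⟩ := hΓ
  have h := trace_krausAdjoint_mul E 1 ρ
  simp only [krausAdjoint, mul_one, one_mul, h1] at h
  rw [hE, h]

theorem IsUnitalChannel.apply_maxMixed (hΓ : IsUnitalChannel Γ) :
    Γ (maxMixed n) = maxMixed n := by
  obtain ⟨⟨r, E, -, hE⟩, h1⟩ := hΓ
  rw [hE] at h1 ⊢
  simp only [maxMixed, Matrix.mul_smul, Matrix.smul_mul, ← Finset.smul_sum, h1]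

end

namespace MemorylessAlgorithm

variable {n : ℕ} (W : MemorylessAlgorithm n)

/-- The algorithm that sends every copy through a channel before it is measured. -/
def withNoise {r : ℕ} (E : Fin r → QMat n) (hE : ∑ i, (E i).conjTranspose * E i = 1) :
    MemorylessAlgorithm n where
  copies := W.copies
  Out := W.Out
  povm h o := krausAdjoint E (W.povm h o)
  posSemidef h o := posSemidef_krausAdjoint E (W.posSemidef h o)
  sum_eq_one h := by
    rw [← krausAdjoint_sum, W.sum_eq_one]
    simpa only [krausAdjoint, mul_one] using hE
  accept := W.accept

theorem acceptFrom_withNoise {r : ℕ} (E : Fin r → QMat n)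
    (hE : ∑ i, (E i).conjTranspose * E i = 1) (ρ : QMat n) (t : ℕ) (h : List W.Out) :
    (W.withNoise E hE).acceptFrom ρ t h =
      W.acceptFrom (∑ i, E i * ρ * (E i).conjTranspose) t h := by
  induction t generalizing h with
  | zero => rfl
  | succ t ih =>
    change ∑ o : W.Out, (krausAdjoint E (W.povm h o) * ρ).trace.re *
      (W.withNoise E hE).acceptFrom ρ t (o :: h) = ∑ o, _
    refine Finset.sum_congr rfl fun o _ => ?_
    rw [trace_krausAdjoint_mul]
    exact congrArg _ (ih (o :: h))

theorem exists_withNoise {Γ : QMat n → QMat n} (hΓ : IsChannel Γ) :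
    ∃ V : MemorylessAlgorithm n, V.copies = W.copies ∧
      ∀ ρ, V.acceptProb ρ = W.acceptProb (Γ ρ) := by
  obtain ⟨r, E, h1, hE⟩ := hΓ
  refine ⟨W.withNoise E h1, rfl, fun ρ => ?_⟩
  rw [hE]
  exact W.acceptFrom_withNoise E h1 ρ _ _

/-- The noiseless bound for the algorithm that has absorbed the noise. Unitality is what keeps the
maximally mixed state as the reference point. -/
theorem abs_haarProb_sub_le {Γ : QMat n → QMat n} (hΓ : IsUnitalChannel Γ) :
    |W.haarProb Γ - W.acceptProb (maxMixed n)| ≤ (W.copies : ℝ) ^ 2 / 2 ^ n := by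
  obtain ⟨V, hV, hp⟩ := W.exists_withNoise hΓ.1
  have h := V.abs_haarProb_id_sub_le
  rw [hV, hp, hΓ.apply_maxMixed] at h
  simpa only [haarProb, hp, id] using h

theorem abs_haarProb_sub_haarProb_id_le {Γ : QMat n → QMat n} (hΓ : IsUnitalChannel Γ) :
    |W.haarProb Γ - W.haarProb id| ≤ 2 * ((W.copies : ℝ) ^ 2 / 2 ^ n) := by
  have h1 := W.abs_haarProb_sub_le hΓ
  have h2 := W.abs_haarProb_id_sub_le
  rw [abs_sub_comm] at h2
  have h3 := abs_sub_le (W.haarProb Γ) (W.acceptProb (maxMixed n)) (W.haarProb id)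
  linarith

/-- Measurements do not distinguish states at trace distance `ε` by more than `ε` per copy. -/
theorem abs_acceptFrom_sub_le {ε : ℝ} {A B : QMat n} (hAB : TraceClose ε A B) (hA : IsPositive A)
    (hA1 : A.trace.re = 1) (hB : IsPositive B) (hB1 : B.trace.re = 1) (t : ℕ) (h : List W.Out) :
    |W.acceptFrom A t h - W.acceptFrom B t h| ≤ t * ε := by
  induction t generalizing h with
  | zero => simp [acceptFrom]
  | succ t ih =>
    have hf (o : W.Out) := W.acceptFrom_mem_Icc hB hB1 t (o :: h)
    -- Hybrid argument on the next copy. The first term changes the later copies after an outcome on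
    -- `A`; the second changes only this copy. In the latter, the later acceptance probabilities on
    -- `B`, which lie in `[0, 1]`, weight the POVM elements and combine them into a single effect,
    -- so `TraceClose` costs `ε` once and not once per outcome.
    have hsplit : W.acceptFrom A (t + 1) h - W.acceptFrom B (t + 1) h =
        ∑ o, (W.povm h o * A).trace.re *
          (W.acceptFrom A t (o :: h) - W.acceptFrom B t (o :: h)) +
        (((∑ o, ((W.acceptFrom B t (o :: h) : ℝ) : ℂ) • W.povm h o) * (A - B)).trace).re := by
      simp only [acceptFrom, Finset.sum_mul, Matrix.trace_sum, Complex.re_sum, Matrix.smul_mul,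
        Matrix.trace_smul, smul_eq_mul, Complex.re_ofReal_mul, mul_sub, Matrix.trace_sub,
        Complex.sub_re, Finset.sum_sub_distrib]
      simp only [mul_comm]
      ring
    have hE := hAB (∑ o, ((W.acceptFrom B t (o :: h) : ℝ) : ℂ) • W.povm h o)
      (Matrix.posSemidef_sum _ fun o _ => (W.posSemidef h o).smul (by
        exact_mod_cast (hf o).1)) (by
        have : (1 : QMat n) - ∑ o, ((W.acceptFrom B t (o :: h) : ℝ) : ℂ) • W.povm h o =
            ∑ o, ((1 - W.acceptFrom B t (o :: h) : ℝ) : ℂ) • W.povm h o := by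
          rw [← W.sum_eq_one h, ← Finset.sum_sub_distrib]
          refine Finset.sum_congr rfl fun o _ => ?_
          push_cast
          rw [sub_smul, one_smul]
        rw [this]
        exact Matrix.posSemidef_sum _ fun o _ => (W.posSemidef h o).smul (by
          exact_mod_cast sub_nonneg.2 (hf o).2))
    rw [hsplit]
    refine (abs_add_le _ _).trans ?_
    have h1 : |∑ o, (W.povm h o * A).trace.re *
        (W.acceptFrom A t (o :: h) - W.acceptFrom B t (o :: h))| ≤ t * ε := by
      refine (Finset.abs_sum_le_sum_abs _ _).trans ?_
      calc _ ≤ ∑ o, (W.povm h o * A).trace.re * (t * ε) := by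
            refine Finset.sum_le_sum fun o _ => ?_
            rw [abs_mul, abs_of_nonneg (hA _ (W.posSemidef h o))]
            exact mul_le_mul_of_nonneg_left (ih _) (hA _ (W.posSemidef h o))
        _ = t * ε := by rw [← Finset.sum_mul, W.sum_trace_povm, hA1, one_mul]
    have h2 := (Complex.abs_re_le_norm _).trans hE
    push_cast
    linarith

theorem abs_acceptProb_sub_le {ε : ℝ} {Γ Γ' : QMat n → QMat n} (hΓ : IsChannel Γ)
    (hΓ' : IsChannel Γ') {ψ : PureState n} (h : TraceClose ε (Γ (proj ψ)) (Γ' (proj ψ))) :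
    |W.acceptProb (Γ (proj ψ)) - W.acceptProb (Γ' (proj ψ))| ≤ W.copies * ε :=
  W.abs_acceptFrom_sub_le h (hΓ.isPositive (isPositive_proj ψ))
    (by rw [hΓ.trace_eq, trace_proj, Complex.one_re]) (hΓ'.isPositive (isPositive_proj ψ))
    (by rw [hΓ'.trace_eq, trace_proj, Complex.one_re]) _ _

theorem abs_haarProb_sub_haarProb_le {ε : ℝ} {Γ Γ' : QMat n → QMat n} (hΓ : IsChannel Γ)
    (hΓ' : IsChannel Γ') (h : ∀ ψ : PureState n, TraceClose ε (Γ (proj ψ)) (Γ' (proj ψ))) :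
    |W.haarProb Γ - W.haarProb Γ'| ≤ W.copies * ε := by
  unfold haarProb
  rw [← integral_sub (W.integrable_acceptProb hΓ.continuous)
    (W.integrable_acceptProb hΓ'.continuous)]
  have := norm_integral_le_of_norm_le_const (μ := haar n)
    (f := fun ψ => W.acceptProb (Γ (proj ψ)) - W.acceptProb (Γ' (proj ψ)))
    (ae_of_all _ fun ψ => W.abs_acceptProb_sub_le hΓ hΓ' (h ψ))
  simpa using this

theorem abs_keyProb_sub_keyProb_le {ε : ℝ} {Γ Γ' : QMat n → QMat n} (hΓ : IsChannel Γ)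
    (hΓ' : IsChannel Γ') (h : ∀ ψ : PureState n, TraceClose ε (Γ (proj ψ)) (Γ' (proj ψ)))
    {K : Type} [Fintype K] [Nonempty K] (φ : K → PureState n) :
    |W.keyProb φ Γ - W.keyProb φ Γ'| ≤ W.copies * ε := by
  unfold keyProb
  have hK : (0 : ℝ) < Fintype.card K := by exact_mod_cast Fintype.card_pos
  rw [← mul_sub, ← Finset.sum_sub_distrib, abs_mul, abs_of_pos (inv_pos.2 hK),
    inv_mul_le_iff₀ hK]
  refine (Finset.abs_sum_le_sum_abs _ _).trans ?_
  refine (Finset.sum_le_card_nsmul _ _ _ fun k _ =>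
    W.abs_acceptProb_sub_le hΓ hΓ' (h (φ k))).trans ?_
  rw [Finset.card_univ, nsmul_eq_mul]

end MemorylessAlgorithm

/-! ### Copy complexity -/

/-- After squaring, the hypothesis gives `T ^ 2 ≥ ε * 2 ^ n / 2`, and the constant `1 / 2` asks only
for `ε * 2 ^ n / 4`. -/
theorem copies_ge_of_le {n T : ℕ} {ε : ℝ} (hε : 0 < ε) (h : ε ≤ 2 * ((T : ℝ) ^ 2 / 2 ^ n)) :
    1 / 2 * Real.sqrt ε * (2 : ℝ) ^ ((n : ℝ) / 2) ≤ (T : ℝ) := by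
  refine le_of_abs_le (abs_le_of_sq_le_sq ?_ (Nat.cast_nonneg T))
  have h1 : ((2 : ℝ) ^ ((n : ℝ) / 2)) ^ 2 = 2 ^ n := by
    rw [← Real.rpow_natCast, ← Real.rpow_mul (by norm_num), ← Real.rpow_natCast]
    congr 1
    push_cast
    ring
  rw [mul_pow, mul_pow, h1, Real.sq_sqrt hε.le]
  have h2 : (0 : ℝ) < 2 ^ n := by positivity
  rw [← mul_div_assoc, le_div_iff₀ h2] at h
  nlinarith [sq_nonneg (T : ℝ)]

theorem haar_copies_ge {n : ℕ} {Γ : QMat n → QMat n} (hΓ : IsUnitalChannel Γ)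
    (W : MemorylessAlgorithm n) {ε : ℝ} (hε : 0 < ε) :
    (ε ≤ |W.haarProb Γ - W.acceptProb (maxMixed n)| →
      1 / 2 * Real.sqrt ε * (2 : ℝ) ^ ((n : ℝ) / 2) ≤ (W.copies : ℝ)) ∧
    (ε ≤ |W.haarProb Γ - W.haarProb id| →
      1 / 2 * Real.sqrt ε * (2 : ℝ) ^ ((n : ℝ) / 2) ≤ (W.copies : ℝ)) := by
  refine ⟨fun h => copies_ge_of_le hε ?_, fun h => copies_ge_of_le hε ?_⟩
  · have h1 := h.trans (W.abs_haarProb_sub_le hΓ)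
    have h2 : (0 : ℝ) ≤ (W.copies : ℝ) ^ 2 / 2 ^ n := by positivity
    linarith
  · exact h.trans (W.abs_haarProb_sub_haarProb_id_le hΓ)

/-- Noise absorbed into the measurement costs no copies, so `δ` also bounds the advantage between
noisy keyed states and noisy Haar states. The excess `ε` must come from telling noisy from noiseless
Haar states. -/
theorem key_copies_ge {n : ℕ} {Γ : QMat n → QMat n} (hΓ : IsUnitalChannel Γ) {K : Type} [Fintype K]
    (φ : K → PureState n) {T : ℕ} {δ : ℝ}
    (hδ : ∀ V : MemorylessAlgorithm n, V.copies = T → |V.keyProb φ id - V.haarProb id| ≤ δ)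
    (W : MemorylessAlgorithm n) (hW : W.copies = T) {ε : ℝ} (hε : 0 < ε)
    (h : δ + ε ≤ |W.keyProb φ Γ - W.haarProb id|) :
    1 / 2 * Real.sqrt ε * (2 : ℝ) ^ ((n : ℝ) / 2) ≤ (T : ℝ) := by
  refine copies_ge_of_le hε ?_
  obtain ⟨V, hV, hp⟩ := W.exists_withNoise hΓ.1
  have h1 := hδ V (hV.trans hW)
  have h2 := W.abs_haarProb_sub_haarProb_id_le hΓ
  have h3 : V.keyProb φ id = W.keyProb φ Γ := by
    simp only [MemorylessAlgorithm.keyProb, hp, id]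
  have h4 : V.haarProb id = W.haarProb Γ := by
    simp only [MemorylessAlgorithm.haarProb, hp, id]
  rw [h3, h4] at h1
  rw [hW] at h2
  have h5 := abs_sub_le (W.keyProb φ Γ) (W.haarProb Γ) (W.haarProb id)
  linarith

/-! ### Circuits on larger registers -/

section Embed

variable {Q R : Type}

theorem extend_injective {f : Q → R} (hf : f.Injective) (b : R → Bool) :
    Function.Injective fun z : Q → Bool => Function.extend f z b := by
  intro z z' h
  funext w
  simpa only [hf.extend_apply] using congrFun h (f w)

theorem extend_update [DecidableEq Q] [DecidableEq R] {f : Q → R} (hf : f.Injective)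
    (b : R → Bool) (z : Q → Bool) (w : Q) (a : Bool) : Function.update (Function.extend f z b) (f w) a =
      Function.extend f (Function.update z w a) b := by
  funext v
  by_cases hv : ∃ q, f q = v
  · obtain ⟨q, rfl⟩ := hv
    rw [hf.extend_apply]
    by_cases hq : q = w
    · simp [hq]
    · rw [Function.update_of_ne (hf.ne hq), Function.update_of_ne hq, hf.extend_apply]
  · rw [Function.extend_apply' _ _ _ hv, Function.update_of_ne (fun h => hv ⟨w, h.symm⟩),
      Function.extend_apply' _ _ _ hv]

variable [Fintype Q] [DecidableEq Q] [Fintype R]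

/-- The isometry that adds to the register `Q`, placed in `R` by `f`, idle qubits in the basis
state `b`. -/
def embedMatrix (f : Q → R) (b : R → Bool) : Matrix (R → Bool) (Q → Bool) ℂ :=
  fun x z => if x = Function.extend f z b then 1 else 0

/-- The state `σ` together with idle qubits in the basis state `b`. -/
def embedState (f : Q → R) (b : R → Bool) (σ : Op Q) : Op R :=
  embedMatrix f b * σ * (embedMatrix f b).conjTranspose

theorem embedState_eq_zero (f : Q → R) (b : R → Bool) (σ : Op Q) {x y : R → Bool}
    (h : x ∉ Set.range (fun z : Q → Bool => Function.extend f z b) ∨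
      y ∉ Set.range (fun z : Q → Bool => Function.extend f z b)) :
    embedState f b σ x y = 0 := by
  simp only [embedState, embedMatrix, Matrix.mul_apply, Matrix.conjTranspose_apply]
  rcases h with h | h
  · refine Finset.sum_eq_zero fun z' _ => ?_
    rw [Finset.sum_eq_zero fun z _ => ?_, zero_mul]
    rw [if_neg fun e => h ⟨z, e.symm⟩, zero_mul]
  · refine Finset.sum_eq_zero fun z' _ => ?_
    rw [if_neg fun e => h ⟨z', e.symm⟩, star_zero, mul_zero]

theorem embedState_extend {f : Q → R} (hf : f.Injective) (b : R → Bool) (σ : Op Q)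
    (z z' : Q → Bool) :
    embedState f b σ (Function.extend f z b) (Function.extend f z' b) = σ z z' := by
  simp [embedState, embedMatrix, Matrix.mul_apply, (extend_injective hf b).eq_iff]

/-- In this form the matrix refers to basis states only through `Function.update`, which commutes
with the extension by idle qubits. -/
theorem onQubit_eq_sum (w : Q) (u : Matrix Bool Bool ℂ) (x y : Q → Bool) :
    onQubit w u x y = ∑ a, if x = Function.update y w a then u a (y w) else 0 := by
  rw [onQubit]
  split_ifs with h
  · rw [Finset.sum_eq_single (x w)]
    · rw [if_pos]
      funext v
      by_cases hv : v = w
      · simp [hv]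
      · rw [Function.update_of_ne hv, h v hv]
    · intro a _ ha
      rw [if_neg]
      intro e
      exact ha (by rw [e, Function.update_self])
    · simp
  · refine (Finset.sum_eq_zero fun a _ => if_neg fun e => h fun v hv => ?_).symm
    rw [e, Function.update_of_ne hv]

variable [DecidableEq R]

theorem onQubit_mul_embedMatrix {f : Q → R} (hf : f.Injective) (b : R → Bool) (w : Q)
    (u : Matrix Bool Bool ℂ) :
    onQubit (f w) u * embedMatrix f b = embedMatrix f b * onQubit w u := by
  ext x z
  have h1 : (onQubit (f w) u * embedMatrix f b) x z =
      onQubit (f w) u x (Function.extend f z b) := by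
    simp [Matrix.mul_apply, embedMatrix]
  rw [h1, onQubit_eq_sum, Matrix.mul_apply]
  simp only [onQubit_eq_sum, Finset.mul_sum]
  rw [Finset.sum_comm]
  refine Finset.sum_congr rfl fun a _ => ?_
  simp [embedMatrix, hf.extend_apply, extend_update hf]

theorem cnotMatrix_mul_embedMatrix {f : Q → R} (hf : f.Injective) (b : R → Bool) (c w : Q) :
    cnotMatrix (f c) (f w) * embedMatrix f b = embedMatrix f b * cnotMatrix c w := by
  ext x z
  simp [Matrix.mul_apply, embedMatrix, cnotMatrix, hf.extend_apply, extend_update hf]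

theorem conj_embedState {f : Q → R} {b : R → Bool} {K : Op R} {L : Op Q}
    (h : K * embedMatrix f b = embedMatrix f b * L) (σ : Op Q) :
    K * embedState f b σ * K.conjTranspose = embedState f b (L * σ * L.conjTranspose) := by
  have h' := congrArg Matrix.conjTranspose h
  rw [Matrix.conjTranspose_mul, Matrix.conjTranspose_mul] at h'
  calc K * embedState f b σ * K.conjTranspose
      = (K * embedMatrix f b) * σ * ((embedMatrix f b).conjTranspose * K.conjTranspose) := by
        simp only [embedState, Matrix.mul_assoc]
    _ = _ := by
        rw [h, h']
        simp only [embedState, Matrix.mul_assoc]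

/-- Renaming of qubits. -/
def Gate.map (f : Q → R) : Gate Q → Gate R
  | .had w => .had (f w)
  | .tee w => .tee (f w)
  | .cnot c w => .cnot (f c) (f w)
  | .reset w => .reset (f w)

/-- Each Kraus operator of a gate intertwines with the isometry `embedMatrix f b`, since it never
touches the idle qubits. -/
theorem Gate.apply_embedState {f : Q → R} (hf : f.Injective) (b : R → Bool) (g : Gate Q)
    (σ : Op Q) : (g.map f).apply (embedState f b σ) = embedState f b (g.apply σ) := by
  cases g with
  | had w => exact conj_embedState (onQubit_mul_embedMatrix hf b w _) σ
  | tee w => exact conj_embedState (onQubit_mul_embedMatrix hf b w _) σ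
  | cnot c w => exact conj_embedState (cnotMatrix_mul_embedMatrix hf b c w) σ
  | reset w =>
    simp only [Gate.map, Gate.apply]
    rw [Finset.sum_congr rfl fun i _ => conj_embedState (onQubit_mul_embedMatrix hf b w _) σ]
    simp only [embedState, Matrix.mul_sum, Matrix.sum_mul]

end Embed

/-- The inclusion of a register in a larger one. -/
def Reg.castLE (n : ℕ) {s s' a a' : ℕ} (hs : s ≤ s') (ha : a ≤ a') : Reg n s a → Reg n s' a' :=
  Sum.map id (Sum.map (Fin.castLE hs) (Fin.castLE ha))

theorem Reg.castLE_injective (n : ℕ) {s s' a a' : ℕ} (hs : s ≤ s') (ha : a ≤ a') :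
    (Reg.castLE n hs ha).Injective :=
  Function.injective_id.sumMap
    ((Fin.castLE_injective hs).sumMap (Fin.castLE_injective ha))

/-! ### Circuits on a register with more classical bits and ancillas -/

section Locate

variable {n s s' a a' : ℕ} (hs : s ≤ s') (ha : a ≤ a')

theorem Wire.locate_castLE {w : Wire} {r : Reg n s a} (h : w.locate n s a = some r) :
    w.locate n s' a' = some (Reg.castLE n hs ha r) := by
  cases w with
  | state i =>
    simp only [Wire.locate, Option.dite_none_right_eq_some, Option.some.injEq] at h ⊢
    obtain ⟨hi, rfl⟩ := h
    exact ⟨hi, rfl⟩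
  | bit i =>
    simp only [Wire.locate, Option.dite_none_right_eq_some, Option.some.injEq] at h ⊢
    obtain ⟨hi, rfl⟩ := h
    exact ⟨hi.trans_le hs, rfl⟩
  | anc i =>
    simp only [Wire.locate, Option.dite_none_right_eq_some, Option.some.injEq] at h ⊢
    obtain ⟨hi, rfl⟩ := h
    exact ⟨hi.trans_le ha, rfl⟩

theorem Gate.locate_castLE {g : Gate Wire} {g' : Gate (Reg n s a)}
    (h : g.locate n s a = some g') :
    g.locate n s' a' = some (g'.map (Reg.castLE n hs ha)) := by
  cases g with
  | had w =>
    obtain ⟨r, hr, rfl⟩ := Option.map_eq_some_iff.1 h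
    simp only [Gate.locate, Wire.locate_castLE hs ha hr, Option.map_some, Gate.map]
  | tee w =>
    obtain ⟨r, hr, rfl⟩ := Option.map_eq_some_iff.1 h
    simp only [Gate.locate, Wire.locate_castLE hs ha hr, Option.map_some, Gate.map]
  | reset w =>
    obtain ⟨r, hr, rfl⟩ := Option.map_eq_some_iff.1 h
    simp only [Gate.locate, Wire.locate_castLE hs ha hr, Option.map_some, Gate.map]
  | cnot c w =>
    obtain ⟨q, hq, h'⟩ := Option.bind_eq_some_iff.1 h
    obtain ⟨r, hr, rfl⟩ := Option.map_eq_some_iff.1 h'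
    simp only [Gate.locate, Wire.locate_castLE hs ha hr, Wire.locate_castLE hs ha hq,
      Option.map_some, Option.bind_some, Gate.map]

theorem Circuit.Valid.mono {n s s' a a' : ℕ} {C : Circuit} (hC : C.Valid n s a) (hs : s ≤ s')
    (ha : a ≤ a') : C.Valid n s' a' := by
  intro g hg
  obtain ⟨g', hg'⟩ := Option.isSome_iff_exists.1 (hC g hg).2
  exact ⟨(hC g hg).1, by rw [Gate.locate_castLE hs ha hg']; rfl⟩

theorem Circuit.run_embedState {C : Circuit} (hC : C.Valid n s a) (b : Reg n s' a' → Bool)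
    (σ : Op (Reg n s a)) :
    C.run n s' a' (embedState (Reg.castLE n hs ha) b σ) =
      embedState (Reg.castLE n hs ha) b (C.run n s a σ) := by
  induction C generalizing σ with
  | nil => rfl
  | cons g C ih =>
    obtain ⟨g', hg'⟩ := Option.isSome_iff_exists.1 (hC g List.mem_cons_self).2
    have h1 : List.filterMap (Gate.locate n s a) (g :: C) =
        g' :: List.filterMap (Gate.locate n s a) C := List.filterMap_cons_some hg'
    have h2 : List.filterMap (Gate.locate n s' a') (g :: C) =
        g'.map (Reg.castLE n hs ha) :: List.filterMap (Gate.locate n s' a') C :=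
      List.filterMap_cons_some (Gate.locate_castLE hs ha hg')
    have := ih (fun g hg => hC g (List.mem_cons_of_mem _ hg)) (g'.apply σ)
    simp only [Circuit.run] at this ⊢
    rw [h1, h2, List.foldl_cons, List.foldl_cons,
      Gate.apply_embedState (Reg.castLE_injective n hs ha), this]

/-- The content of a register in which only classical bits are set. -/
def idleBits (n a : ℕ) {s : ℕ} (m : Fin s → Bool) : Reg n s a → Bool :=
  Sum.elim (fun _ => false) (Sum.elim m fun _ => false)

/-- Bits and ancillas outside the small register may count as idle in their prepared values, so a
circuit on fewer wires can be run as if they were absent. -/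
theorem prepare_eq_embedState (ρ : QMat n) (m : Fin s' → Bool) :
    prepare a' ρ m = embedState (Reg.castLE n hs ha) (idleBits n a' m)
      (prepare a ρ fun i => m (Fin.castLE hs i)) := by
  have hf := Reg.castLE_injective n hs ha
  let ext' (z : Reg n s a → Bool) : Reg n s' a' → Bool :=
    Function.extend (Reg.castLE n hs ha) z (idleBits n a' m)
  have hcond (z : Reg n s a → Bool) :
      ((∀ i, ext' z (.inr (.inl i)) = m i) ∧ (∀ i, ext' z (.inr (.inr i)) = false)) ↔
      ((∀ i, z (.inr (.inl i)) = m (Fin.castLE hs i)) ∧ (∀ i, z (.inr (.inr i)) = false)) := by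
    have hin (r : Reg n s a) : ext' z (Reg.castLE n hs ha r) = z r := hf.extend_apply _ _ _
    constructor
    · rintro ⟨h1, h2⟩
      exact ⟨fun i => (hin (.inr (.inl i))).symm.trans (h1 _),
        fun i => (hin (.inr (.inr i))).symm.trans (h2 _)⟩
    · rintro ⟨h1, h2⟩
      constructor
      · intro i
        by_cases hv : ∃ q, Reg.castLE n hs ha q = .inr (.inl i)
        · obtain ⟨q | q | q, hq⟩ := hv
          · simp [Reg.castLE] at hq
          · rw [← hq, hin, h1]
            simp only [Reg.castLE, Sum.map_inr, Sum.map_inl, Sum.inr.injEq, Sum.inl.injEq] at hq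
            rw [hq]
          · simp [Reg.castLE] at hq
        · exact Function.extend_apply' _ _ _ hv
      · intro i
        by_cases hv : ∃ q, Reg.castLE n hs ha q = .inr (.inr i)
        · obtain ⟨q | q | q, hq⟩ := hv
          · simp [Reg.castLE] at hq
          · simp [Reg.castLE] at hq
          · rw [← hq, hin, h2]
        · exact Function.extend_apply' _ _ _ hv
  -- A basis state that carries the prepared bits and ancillas agrees with `idleBits` off the small
  -- register, so outside the range of `ext'` both matrices vanish.
  have hrange (x : Reg n s' a' → Bool)
      (hx : (∀ i, x (.inr (.inl i)) = m i) ∧ (∀ i, x (.inr (.inr i)) = false)) :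
      x ∈ Set.range ext' := by
    refine ⟨fun r => x (Reg.castLE n hs ha r), ?_⟩
    funext v
    by_cases hv : ∃ q, Reg.castLE n hs ha q = v
    · obtain ⟨q, rfl⟩ := hv
      exact hf.extend_apply _ _ _
    · refine (Function.extend_apply' _ _ _ hv).trans ?_
      rcases v with v | v | v
      · exact absurd ⟨.inl v, rfl⟩ hv
      · exact (hx.1 v).symm
      · exact (hx.2 v).symm
  funext x y
  by_cases hx : x ∈ Set.range ext'
  · by_cases hy : y ∈ Set.range ext'
    · obtain ⟨z, rfl⟩ := hx
      obtain ⟨z', rfl⟩ := hy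
      have hst (z : Reg n s a → Bool) (i : Fin n) : ext' z (.inl i) = z (.inl i) :=
        hf.extend_apply _ _ (.inl i)
      refine Eq.trans ?_ (embedState_extend hf _ _ z z').symm
      simp only [prepare, hcond, hst]
    · rw [embedState_eq_zero _ _ _ (Or.inr hy)]
      exact if_neg fun h => hy (hrange y h.2)
  · rw [embedState_eq_zero _ _ _ (Or.inl hx)]
    exact if_neg fun h => hx (hrange x h.1)

/-- Only ancillas are added here: the diagonal entries are carried over with the same classical
bits, and all new ones are zero. -/
theorem readProb_embedState (b : Reg n s a' → Bool) (σ : Op (Reg n s a)) (m : Fin s → Bool) :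
    readProb (embedState (Reg.castLE n le_rfl ha) b σ) m = readProb σ m := by
  have hf := Reg.castLE_injective n (le_refl s) ha
  refine (Fintype.sum_of_injective _ (extend_injective hf b) _ _ ?_ ?_).symm
  · intro x hx
    rw [embedState_eq_zero _ _ _ (Or.inl hx), ite_self]
  · intro z
    have hb (i : Fin s) : Function.extend (Reg.castLE n le_rfl ha) z b (.inr (.inl i)) =
        z (.inr (.inl i)) := hf.extend_apply z b (.inr (.inl i))
    simp only [hb, embedState_extend hf]

end Locate

/-! ### Noise circuits in front of measurement circuits -/

theorem Circuit.run_append (C D : Circuit) (n s a : ℕ) (ρ : Op (Reg n s a)) :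
    Circuit.run (C ++ D) n s a ρ = D.run n s a (C.run n s a ρ) := by
  simp only [Circuit.run, List.filterMap_append, List.foldl_append]

/-- A circuit for a channel, run before another circuit that has fresh ancillas. -/
theorem readProb_run_append {n s a a' : ℕ} {D C : Circuit} (hD : D.Valid n 0 a)
    (hC : C.Valid n s a') {Γ : QMat n → QMat n}
    (hΓ : ∀ ρ, D.run n 0 a (prepare a ρ Fin.elim0) = prepare a (Γ ρ) Fin.elim0)
    (ρ : QMat n) (m o : Fin s → Bool) :
    readProb (Circuit.run (D ++ C) n s (a + a') (prepare (a + a') ρ m)) o =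
      readProb (C.run n s a' (prepare a' (Γ ρ) m)) o := by
  have h0 : (fun i => m (Fin.castLE (Nat.zero_le s) i)) = Fin.elim0 := Subsingleton.elim _ _
  -- The ancillas of the two circuits overlap; `a + a'` is merely a common upper bound. The sharing
  -- is sound because the noise circuit returns its ancillas to zero, so its output is a prepared
  -- state of the full register and can be restricted afresh to the wires of `C`.
  rw [Circuit.run_append,
    prepare_eq_embedState (Nat.zero_le s) (Nat.le_add_right a a') ρ m, h0,
    Circuit.run_embedState _ _ hD, hΓ, ← h0, ← prepare_eq_embedState,
    prepare_eq_embedState le_rfl (Nat.le_add_left a' a) (Γ ρ) m, Circuit.run_embedState _ _ hC,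
    readProb_embedState]
  rfl

/-- The noise circuit is prefixed in every round. Memory updates are labelled by the same outcomes
and the decision is unchanged, so only the circuits and the ancilla count differ. -/
theorem IsQPT.withNoise {W : ∀ n, MemorylessAlgorithm n} (hW : IsQPT W) {D : ℕ → Circuit}
    {a : Polynomial ℕ} (hDu : Uniform D) (hD : ∀ n, (D n).Valid n 0 (a.eval n))
    {Γ : ∀ n, QMat n → QMat n}
    (hrun : ∀ n ρ, (D n).run n 0 (a.eval n) (prepare (a.eval n) ρ Fin.elim0) =
      prepare (a.eval n) (Γ n ρ) Fin.elim0)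
    {r : ℕ → ℕ} (E : ∀ n, Fin (r n) → QMat n)
    (hE : ∀ n, ∑ i, (E n i).conjTranspose * E n i = 1)
    (hΓ : ∀ n ρ, Γ n ρ = ∑ i, E n i * ρ * (E n i).conjTranspose) :
    IsQPT fun n => (W n).withNoise (E n) (hE n) := by
  obtain ⟨C, T, s, a', hCu, hC, h⟩ := hW
  refine ⟨fun n => D n ++ C n, T, s, a + a', Uniform.append D C hDu hCu, fun n g hg => ?_,
    fun n => ?_⟩
  · rw [Polynomial.eval_add]
    rcases List.mem_append.1 hg with hg | hg
    · exact (hD n).mono (Nat.zero_le _) (Nat.le_add_right _ _) g hg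
    · exact (hC n).mono le_rfl (Nat.le_add_left _ _) g hg
  · obtain ⟨hT, e, h1, h2⟩ := h n
    refine ⟨hT, e, fun h o ρ => ?_, h2⟩
    have h3 := h1 h o (Γ n ρ)
    have h4 := trace_krausAdjoint_mul (E n) ((W n).povm h o) ρ
    rw [← hΓ, h3, ← readProb_run_append (hD n) (hC n) (hrun n)] at h4
    rw [Polynomial.eval_add]
    exact h4

/-! ### Negligible functions -/

theorem Negligible.mono {f g : ℕ → ℝ} (hf : Negligible f) (h : ∀ n, g n ≤ f n) : Negligible g :=
  fun c => (hf c).imp fun _ hn₀ n hn => (h n).trans_lt (hn₀ n hn)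

theorem Negligible.add {f g : ℕ → ℝ} (hf : Negligible f) (hg : Negligible g) :
    Negligible fun n => f n + g n := by
  intro c
  -- The spare power of `n` absorbs the factor `2` once `n ≥ 2`.
  obtain ⟨n₁, h₁⟩ := hf (c + 1)
  obtain ⟨n₂, h₂⟩ := hg (c + 1)
  refine ⟨max 2 (max n₁ n₂), fun n hn => ?_⟩
  simp only [max_lt_iff] at hn
  have h2 : (2 : ℝ) ≤ n := by exact_mod_cast hn.1.le
  have hp : (0 : ℝ) < (n : ℝ) ^ c := by positivity
  refine (add_lt_add (h₁ n hn.2.1) (h₂ n hn.2.2)).trans_le ?_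
  rw [pow_succ, mul_inv, ← mul_add]
  refine mul_le_of_le_one_right (by positivity) ?_
  rw [← two_mul, ← div_eq_mul_inv, div_le_one (by linarith)]
  exact h2

theorem exists_eval_le_pow (q : Polynomial ℕ) : ∃ k n₀ : ℕ, ∀ n, n₀ < n → q.eval n ≤ n ^ k := by
  induction q using Polynomial.induction_on with
  | C a => exact ⟨1, a, fun n hn => by simpa using hn.le⟩
  | add p q hp hq =>
    obtain ⟨k₁, n₁, h₁⟩ := hp
    obtain ⟨k₂, n₂, h₂⟩ := hq
    refine ⟨max k₁ k₂ + 1, max 2 (max n₁ n₂), fun n hn => ?_⟩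
    simp only [max_lt_iff] at hn
    have hn0 : 0 < n := by omega
    have e₁ := (h₁ n hn.2.1).trans (Nat.pow_le_pow_right hn0 (le_max_left k₁ k₂))
    have e₂ := (h₂ n hn.2.2).trans (Nat.pow_le_pow_right hn0 (le_max_right k₁ k₂))
    rw [Polynomial.eval_add, pow_succ]
    nlinarith [hn.1, Nat.zero_le (n ^ max k₁ k₂)]
  | monomial m a h =>
    obtain ⟨k, n₀, h⟩ := h
    refine ⟨k + 1, n₀, fun n hn => ?_⟩
    have := Nat.mul_le_mul_right n (h n hn)
    simpa [pow_succ, mul_assoc] using this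

theorem Negligible.eval_mul {f : ℕ → ℝ} (hf : Negligible f) (h0 : ∀ n, 0 ≤ f n)
    (q : Polynomial ℕ) : Negligible fun n => (q.eval n : ℕ) * f n := by
  intro c
  obtain ⟨k, n₁, h₁⟩ := exists_eval_le_pow q
  obtain ⟨n₂, h₂⟩ := hf (c + k)
  refine ⟨max n₁ n₂, fun n hn => ?_⟩
  simp only [max_lt_iff] at hn
  have hn0 : (0 : ℝ) < n := by exact_mod_cast (Nat.zero_le _).trans_lt hn.1
  have hq : ((q.eval n : ℕ) : ℝ) ≤ (n : ℝ) ^ k := by exact_mod_cast h₁ n hn.1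
  calc _ ≤ (n : ℝ) ^ k * f n := mul_le_mul_of_nonneg_right hq (h0 n)
    _ < (n : ℝ) ^ k * ((n : ℝ) ^ (c + k))⁻¹ :=
        mul_lt_mul_of_pos_left (h₂ n hn.2) (by positivity)
    _ = ((n : ℝ) ^ c)⁻¹ := by
        rw [pow_add]
        field_simp

theorem negligible_inv_two_pow : Negligible fun n => ((2 : ℝ) ^ n)⁻¹ := by
  intro c
  have h := (tendsto_pow_const_div_const_pow_of_one_lt c (one_lt_two (α := ℝ))).eventually_lt_const
    (zero_lt_one (α := ℝ))
  obtain ⟨n₀, hn₀⟩ := Filter.eventually_atTop.1 h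
  refine ⟨n₀, fun n hn => ?_⟩
  have hn0 : (0 : ℝ) < n := by exact_mod_cast (Nat.zero_le _).trans_lt hn
  have h1 := hn₀ n hn.le
  rw [div_lt_one (by positivity)] at h1
  exact inv_strictAnti₀ (by positivity) h1

/-! ### Security of noisy memoryless PRS -/

theorem TraceClose.nonneg {n : ℕ} {ε : ℝ} {A B : QMat n} (h : TraceClose ε A B) : 0 ≤ ε := by
  simpa using h 0 Matrix.PosSemidef.zero (by simpa using Matrix.PosSemidef.one)

/-- A hybrid chain: noisy keyed states, keyed states under the implemented channel `Γ'`, Haar states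
under `Γ'`, Haar states under `Γ`, noiseless Haar states. Only the second link uses
pseudorandomness; the last one is statistical and uses unitality, which is assumed of `Γ` alone. -/
theorem negligible_noisy_advantage {κ : Polynomial ℕ}
    {φ : ∀ n, (Fin (κ.eval n) → Bool) → PureState n}
    (hφ : IsMemorylessPRS κ φ) {Γ : ∀ n, QMat n → QMat n} (hΓ : ∀ n, IsUnitalChannel (Γ n))
    (hΓe : IsEfficientNoise Γ) {W : ∀ n, MemorylessAlgorithm n} (hW : IsQPT W) :
    Negligible fun n => |(W n).keyProb (φ n) (Γ n) - (W n).haarProb id| := by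
  obtain ⟨D, a, Γ', ε, hDu, hD, hΓ', hε, hrun, hclose⟩ := hΓe
  choose r E hE1 hE using hΓ'
  have hch (n : ℕ) : IsChannel (Γ' n) := ⟨r n, E n, hE1 n, hE n⟩
  -- The adversary that performs `Γ'` itself is efficient, so it is covered by the security of the
  -- noiseless PRS.
  have hV := hφ.indistinguishable _ (hW.withNoise hDu hD hrun E hE1 hE)
  obtain ⟨_, T, _, _, _, _, hT⟩ := hW
  have hTn (n : ℕ) : (W n).copies = T.eval n := (hT n).1
  have hp (n : ℕ) (ρ : QMat n) :
      ((W n).withNoise (E n) (hE1 n)).acceptProb ρ = (W n).acceptProb (Γ' n ρ) := by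
    rw [hE]
    exact (W n).acceptFrom_withNoise (E n) (hE1 n) ρ _ _
  have hk (n : ℕ) : ((W n).withNoise (E n) (hE1 n)).keyProb (φ n) id =
      (W n).keyProb (φ n) (Γ' n) := by
    simp only [MemorylessAlgorithm.keyProb, hp, id]
  have hh (n : ℕ) : ((W n).withNoise (E n) (hE1 n)).haarProb id = (W n).haarProb (Γ' n) := by
    simp only [MemorylessAlgorithm.haarProb, hp, id]
  simp only [hk, hh] at hV
  have hε0 (n : ℕ) : 0 ≤ ε n := (hclose n (φ n fun _ => false)).nonneg
  have b1 := hε.eval_mul hε0 T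
  -- `2 * T ^ 2` is the polynomial in the bound `2 * (T ^ 2 / 2 ^ n)` of the last link; `b1` serves
  -- for both replacements of `Γ` by `Γ'`, at cost `ε` per copy.
  have b2 := negligible_inv_two_pow.eval_mul (fun n => by positivity) (2 * T ^ 2)
  refine ((b1.add hV).add (b1.add b2)).mono fun n => ?_
  have c1 := (W n).abs_keyProb_sub_keyProb_le (hΓ n).1 (hch n) (hclose n) (φ n)
  have c2 := (W n).abs_haarProb_sub_haarProb_le (hΓ n).1 (hch n) (hclose n)
  have c3 := (W n).abs_haarProb_sub_haarProb_id_le (hΓ n)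
  rw [abs_sub_comm] at c2
  rw [hTn] at c1 c2 c3
  have t1 := abs_sub_le ((W n).keyProb (φ n) (Γ n)) ((W n).keyProb (φ n) (Γ' n))
    ((W n).haarProb id)
  have t2 := abs_sub_le ((W n).keyProb (φ n) (Γ' n)) ((W n).haarProb (Γ' n)) ((W n).haarProb id)
  have t3 := abs_sub_le ((W n).haarProb (Γ' n)) ((W n).haarProb (Γ n)) ((W n).haarProb id)
  have e : (((2 * T ^ 2 : Polynomial ℕ).eval n : ℕ) : ℝ) * ((2 : ℝ) ^ n)⁻¹ =
      2 * (((T.eval n : ℕ) : ℝ) ^ 2 / 2 ^ n) := by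
    simp only [Polynomial.eval_mul, Polynomial.eval_pow, Polynomial.eval_ofNat]
    push_cast
    ring
  rw [e]
  linarith

end

end MemorylessPRS

theorem mainTheorem8 :
    -- any unital noise, any adversary without quantum memory: `Ω(2^(n/2))` copies are needed to
    -- distinguish noisy Haar random states from the maximally mixed state, and noisy Haar random
    -- states from Haar random states
    (∃ c : ℝ, 0 < c ∧ ∀ (n : ℕ) (Γ : QMat n → QMat n), IsUnitalChannel Γ →
      ∀ (W : MemorylessAlgorithm n) (ε : ℝ), 0 < ε →
        (ε ≤ |W.haarProb Γ - W.acceptProb (maxMixed n)| →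
          c * Real.sqrt ε * (2 : ℝ) ^ ((n : ℝ) / 2) ≤ (W.copies : ℝ)) ∧
        (ε ≤ |W.haarProb Γ - W.haarProb id| →
          c * Real.sqrt ε * (2 : ℝ) ^ ((n : ℝ) / 2) ≤ (W.copies : ℝ))) ∧
    -- any unital noise, any adversary without quantum memory: noise on a family of pseudorandom
    -- states gains an additional advantage `ε` only from `Ω(2^(n/2))` copies
    (∃ c : ℝ, 0 < c ∧ ∀ (n : ℕ) (Γ : QMat n → QMat n), IsUnitalChannel Γ →
      ∀ (K : Type) [Fintype K] [Nonempty K] (φ : K → PureState n) (T : ℕ) (δ : ℝ),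
        (∀ V : MemorylessAlgorithm n, V.copies = T → |V.keyProb φ id - V.haarProb id| ≤ δ) →
        ∀ W : MemorylessAlgorithm n, W.copies = T → ∀ ε : ℝ, 0 < ε →
          δ + ε ≤ |W.keyProb φ Γ - W.haarProb id| →
            c * Real.sqrt ε * (2 : ℝ) ^ ((n : ℝ) / 2) ≤ (T : ℝ)) ∧
    -- efficient unital noise, efficient adversaries without quantum memory: noisy memoryless PRS
    -- are not distinguished from Haar random states with polynomially many copies
    (∀ (κ : Polynomial ℕ) (φ : ∀ n, (Fin (κ.eval n) → Bool) → PureState n),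
      IsMemorylessPRS κ φ →
      ∀ Γ : ∀ n, QMat n → QMat n, (∀ n, IsUnitalChannel (Γ n)) → IsEfficientNoise Γ →
      ∀ W : ∀ n, MemorylessAlgorithm n, IsQPT W →
        Negligible fun n => |(W n).keyProb (φ n) (Γ n) - (W n).haarProb id|) := by
  refine ⟨⟨1 / 2, by norm_num, fun n Γ hΓ W ε hε => haar_copies_ge hΓ W hε⟩,
    ⟨1 / 2, by norm_num, fun n Γ hΓ K _ _ φ T δ hδ W hW ε hε h =>
      key_copies_ge hΓ φ hδ W hW hε h⟩,
    fun κ φ hφ Γ hΓ hΓe W hW => negligible_noisy_advantage hφ hΓ hΓe hW⟩
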